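/- A red tree with $k$ vertices is the Hasse graph of a permutation $\sigma$ of $\{1,\dots,k\}$ that avoids $1324$ and has $\sigma_1=1$; its vertices are the points $(i,\sigma_i)$, with an edge between $i<j$ whenever $\sigma_i<\sigma_j$ and there is no $l$ with $i<l<j$ and $\sigma_i<\sigma_l<\sigma_j$. This is a plane tree rooted at its lower left point, in which the children of a vertex lie to its north-east. A red tree has $k$ positions, namely the places, in the left-to-right order, to the right of the root: one between each two consecutive vertices and one after the last vertex. If a position is not the last one, let $v$ be the nearest vertex to its right and let $x$ be the parent of $v$; the red forest of the position is the graph induced by the vertices situated between $x$ and the position. The red forest of the last position consists of all the vertices except the root. For a plane forest $F$ with $|F|$ vertices (possibly empty), let $\rho_k(F^+)$ be the random variable that records, for a uniformly random $k$-vertex red tree, the proportion of the $k$ positions whose red forest has at least $|F|$ vertices and for which the graph induced by the rightmost $|F|$ vertices of the red forest is isomorphic to $F$ as a plane forest (i.e. by a graph isomorphism that preserves the left-to-right order of the vertices, the vertices of a plane forest being ordered so that each vertex comes before its descendants and the vertices of each subtree come before those of the subtrees to its right). Proposition. Let $F$ be a plane forest with $m=|F|$ vertices and $h$ components. Then $\rho_k(F^+)$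 is concentrated at $$\mu_\rho(F^+)=\frac{1}{2^{2m-h}},$$ that is, for every $\varepsilon>0$ and all sufficiently large $k$, $$\mathbb{P}\Big[\,\big|\rho_k(F^+)-\tfrac{1}{2^{2m-h}}\big|\le\varepsilon\,\Big]>1-\varepsilon ,$$ and this value is its limiting mean: $\lim_{k\to\infty}\mathbb{E}[\rho_k(F^+)]=\frac{1}{2^{2m-h}}$. -/

import Mathlib

open Filter Topology MeasureTheory ProbabilityTheory

/-- Plane forests: a plane forest is either empty, or consists of a first (leftmost) plane tree
followed by a plane forest `rest`; the first tree is given by its root together with the plane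
forest `children` of its principal subtrees. -/
inductive PlaneForest : Type
  | nil : PlaneForest
  | cons (children rest : PlaneForest) : PlaneForest

namespace PlaneForest

/-- The number of vertices of a plane forest. -/
def size : PlaneForest → ℕ
  | nil => 0
  | cons c r => 1 + c.size + r.size

/-- The number of components (trees) of a plane forest. -/
def numTrees : PlaneForest → ℕ
  | nil => 0
  | cons _ r => 1 + r.numTrees

/-- The vertices are numbered `0, …, size - 1` from left to right: a vertex comes before its
descendants, and all vertices of a subtree come before those of the subtrees to its right.
`F.IsRoot b` says that vertex number `b` is the root of one of the trees of `F`. -/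
def IsRoot : PlaneForest → ℕ → Prop
  | nil, _ => False
  | cons c r, b => b = 0 ∨ ∃ b', b = 1 + c.size + b' ∧ r.IsRoot b'

/-- `F.IsChild a b` says that, in the left-to-right numbering, vertex number `b` is a child of
vertex number `a`. -/
def IsChild : PlaneForest → ℕ → ℕ → Prop
  | nil, _, _ => False
  | cons c r, a, b =>
      (a = 0 ∧ ∃ b', b = 1 + b' ∧ c.IsRoot b') ∨
      (∃ a' b', a = 1 + a' ∧ b = 1 + b' ∧ c.IsChild a' b') ∨
      (∃ a' b', a = 1 + c.size + a' ∧ b = 1 + c.size + b' ∧ r.IsChild a' b')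

/-- The graph of a plane forest, on its vertices numbered from left to right. -/
def graph (F : PlaneForest) : SimpleGraph (Fin F.size) :=
  SimpleGraph.fromRel fun a b => F.IsChild a b

theorem numTrees_le_size (F : PlaneForest) : F.numTrees ≤ F.size := by
  induction F with
  | nil => simp [numTrees, size]
  | cons c r _ ihr => simp only [numTrees, size]; omega

end PlaneForest

/-- The permutation `σ` avoids the pattern 1324. -/
def Avoids1324 {k : ℕ} (σ : Equiv.Perm (Fin k)) : Prop :=
  ¬ ∃ a b c d : Fin k, a < b ∧ b < c ∧ c < d ∧ σ a < σ c ∧ σ c < σ b ∧ σ b < σ d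

/-- `HasseCover σ i j`: the point `(j, σ j)` lies to the north-east of the point `(i, σ i)`, and
no point `(l, σ l)` lies strictly between them in both coordinates. -/
def HasseCover {k : ℕ} (σ : Equiv.Perm (Fin k)) (i j : Fin k) : Prop :=
  i < j ∧ σ i < σ j ∧ ¬ ∃ l : Fin k, i < l ∧ l < j ∧ σ i < σ l ∧ σ l < σ j

/-- The Hasse graph of a permutation; the vertex `i` stands for the point `(i, σ i)`, so the order
of `Fin k` is the left-to-right order of the vertices. -/
def hasseGraph {k : ℕ} (σ : Equiv.Perm (Fin k)) : SimpleGraph (Fin k) :=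
  SimpleGraph.fromRel (HasseCover σ)

/-- A red tree with `k` vertices: the Hasse graph of a 1324-avoiding permutation of length `k`
whose first point is its minimum, i.e. in which every point other than the root (the leftmost
point) lies to the north-east of the root. (The Hasse graph of such a permutation is a tree.) -/
@[ext]
structure RedTree (k : ℕ) where
  perm : Equiv.Perm (Fin k)
  nonempty : 0 < k
  avoids : Avoids1324 perm
  root_min : ∀ i j : Fin k, i.val = 0 → perm i ≤ perm j

instance (k : ℕ) : Finite (RedTree k) :=
  Finite.of_injective RedTree.perm fun _ _ h => RedTree.ext h

/-- All sets of red trees are events. -/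
instance (k : ℕ) : MeasurableSpace (RedTree k) := ⊤

instance (k : ℕ) : MeasurableSingletonClass (RedTree k) := ⟨fun _ => trivial⟩

/-- The law of a random red tree with `k` vertices: the uniform distribution. -/
noncomputable def redTreeLaw (k : ℕ) : Measure (RedTree k) :=
  uniformOn (Set.univ : Set (RedTree k))

namespace RedTree

variable {k : ℕ}

/-- The Hasse graph of a red tree. -/
def graph (T : RedTree k) : SimpleGraph (Fin k) := hasseGraph T.perm

/-- `x` is the parent of `v` in the red tree: the edges of the tree go from a parent up to
its children, which lie to its north-east. -/
def IsParent (T : RedTree k) (x v : Fin k) : Prop := HasseCover T.perm x v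

/-- The positions in a `k`-vertex red tree are the `k` places to the right of the root (in the
left-to-right order) where a further point can be inserted; the position `p` is the place
immediately to the right of the vertex `p`. The red forest of the position `p` consists of the
vertices to the left of the position and to the right of `x`, where `x` is the parent of the
nearest vertex `v` to the right of the position. For the last position there is no such `v`,
and its red forest consists of all the vertices other than the root. -/
def redForest (T : RedTree k) (p : Fin k) : Set (Fin k) :=
  {w | w ≤ p ∧ w.val ≠ 0 ∧ ∀ v x : Fin k, v.val = p.val + 1 → T.IsParent x v → x < w}

/-- The red forest of the position `p` has at least `|F|` vertices, and the graph induced by the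
set `S` of its rightmost `|F|` vertices is isomorphic to `F` as a plane forest: by a graph
isomorphism that preserves the left-to-right order of the vertices. -/
def HasFringe (T : RedTree k) (F : PlaneForest) (p : Fin k) : Prop :=
  ∃ S : Set (Fin k), S ⊆ T.redForest p ∧ S.ncard = F.size ∧
    (∀ w ∈ T.redForest p \ S, ∀ s ∈ S, w < s) ∧
    ∃ e : T.graph.induce S ≃g F.graph, ∀ a b : S, a < b ↔ e a < e b

/-- The proportion of positions in a red tree whose red forest has at least `|F|` vertices,
and for which the graph induced by the rightmost `|F|` vertices of the forest is isomorphic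
to `F`. -/
noncomputable def rhoPlus (F : PlaneForest) (T : RedTree k) : ℝ :=
  ({p : Fin k | T.HasFringe F p}.ncard : ℝ) / k

end RedTree

/-- The random variables `ξ n`, each on its own probability space, are concentrated at `μ`: for
every `ε > 0`, for all sufficiently large `n`, `|ξ n - μ| ≤ ε` has probability `> 1 - ε`. -/
def ConcentratedAt {Ω : ℕ → Type} [∀ n, MeasurableSpace (Ω n)] (P : ∀ n, Measure (Ω n))
    (ξ : ∀ n, Ω n → ℝ) (μ : ℝ) : Prop :=
  ∀ ε : ℝ, 0 < ε → ∀ᶠ n in atTop, 1 - ε < (P n).real {ω | |ξ n ω - μ| ≤ ε}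

/-! Below a minimal first point, avoiding `1324` amounts to avoiding `213`. The points to the
south-west of a vertex are its ancestors, and they behave as a stack: passing from `b` to `b + 1`
pushes `b` and then pops the last `descent f b` entries. The descents therefore determine the depths
and the whole order, hence the tree (`RedTree.eq_of_descent_eq`). Counting only the ancestors in
positions at least `s` gives the same walk truncated at `0` (`anc_succ`). So having fringe `F` at a
position is a condition on `m = |F|` consecutive descents: the truncated walk must follow the depths
of `F` and end at `0`, so that no vertex of the window is an ancestor of the next vertex
(`RedTree.hasFringe_iff_mem_windowEvent`).

Replace the descents by independent geometric variables with weights `2⁻¹⁻ʲ`. A truncated step from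
`a` to `b` has probability `2 ^ -(a + 1 - b)`, halved if `b ≠ 0`. The exponents telescope to `m`,
and the `m - h` vertices that are not roots give the halvings; the product is `1 / 2 ^ (2m - h)`
(`prod_halfGeometric_depth`). Windows in a progression of step `m + 1` are independent, so
Hoeffding's inequality makes deviations of the proportion exponentially unlikely
(`measure_abs_sum_window_ge_le`).

To return to uniform red trees with `n + 1` vertices: their descents sum to at most `n`, so each
descent sequence has geometric weight at least `4⁻ⁿ`, and there are at least `catalan n ≥ 4ⁿ /
(2(n+1)²)` trees. Events are thus at most polynomially more likely than in the geometric model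
(`RedTree.redTreeLaw_real_le`), and the exponential bound absorbs this factor. The limiting mean
follows because proportions are bounded. -/

/-! ### Counting ancestors -/

/-- A vertex to the south-west of a later one lies below everything in between: on `0, …, n`,
the function `f` has no pattern `213`. -/
def AvoidsUpTo (f : ℕ → ℕ) (n : ℕ) : Prop :=
  ∀ a b c, a < b → b < c → c ≤ n → f a < f c → f a < f b

/-- The ancestors of `b` in position at least `s`. -/
def ancSet (f : ℕ → ℕ) (s b : ℕ) : Finset ℕ := (Finset.Ico s b).filter fun a => f a < f b

/-- The number of ancestors of `b` in position at least `s`. -/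
def anc (f : ℕ → ℕ) (s b : ℕ) : ℕ := (ancSet f s b).card

/-- The number of levels between a child of `b` and the vertex `b + 1`. -/
def descent (f : ℕ → ℕ) (b : ℕ) : ℕ := anc f 0 b + 1 - anc f 0 (b + 1)

theorem mem_ancSet {f : ℕ → ℕ} {s b a : ℕ} : a ∈ ancSet f s b ↔ (s ≤ a ∧ a < b) ∧ f a < f b := by
  simp [ancSet]

@[simp] theorem anc_self (f : ℕ → ℕ) (s : ℕ) : anc f s s = 0 := by simp [anc, ancSet]

theorem anc_shift (f : ℕ → ℕ) (s i : ℕ) : anc (fun j => f (s + j)) 0 i = anc f s (s + i) := by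
  unfold anc
  refine Finset.card_bij (fun a _ => s + a) ?_ ?_ ?_
  · intro a ha
    simp only [mem_ancSet] at ha ⊢
    omega
  · intro a _ b _ h
    omega
  · intro b hb
    simp only [mem_ancSet] at hb
    refine ⟨b - s, ?_, by omega⟩
    simp only [mem_ancSet]
    have : s + (b - s) = b := by omega
    rw [this]
    omega

theorem card_insert_ancSet (f : ℕ → ℕ) (s b : ℕ) :
    (insert b (ancSet f s b)).card = anc f s b + 1 := by
  rw [Finset.card_insert_of_notMem (by simp [mem_ancSet])]
  rfl

theorem ancSet_succ_subset {f : ℕ → ℕ} {n s b : ℕ} (hf : AvoidsUpTo f n) (hb : b < n) :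
    ancSet f s (b + 1) ⊆ insert b (ancSet f s b) := by
  intro a ha
  rw [mem_ancSet] at ha
  rw [Finset.mem_insert, mem_ancSet]
  rcases eq_or_ne a b with h | h
  · exact Or.inl h
  · exact Or.inr ⟨⟨ha.1.1, by omega⟩, hf a b (b + 1) (by omega) (by omega) (by omega) ha.2⟩

theorem anc_succ_le {f : ℕ → ℕ} {n s b : ℕ} (hf : AvoidsUpTo f n) (hb : b < n) :
    anc f s (b + 1) ≤ anc f s b + 1 := by
  rw [← card_insert_ancSet]
  exact Finset.card_le_card (ancSet_succ_subset hf hb)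

/-- The ancestors in a window evolve by the same descents, truncated at the window. -/
theorem anc_succ {f : ℕ → ℕ} {n s b : ℕ} (hf : AvoidsUpTo f n) (hb : b < n) (hs : s ≤ b) :
    anc f s (b + 1) = anc f s b + 1 - descent f b := by
  have h0 := ancSet_succ_subset (s := 0) hf hb
  have hS := ancSet_succ_subset (s := s) hf hb
  have c0 := Finset.card_sdiff_of_subset h0
  have cS := Finset.card_sdiff_of_subset hS
  rw [card_insert_ancSet] at c0 cS
  have hle := anc_succ_le (s := s) hf hb
  have hd : descent f b =
      (insert b (ancSet f 0 b) \ ancSet f 0 (b + 1)).card := c0.symm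
  have hsub : insert b (ancSet f s b) \ ancSet f s (b + 1) ⊆
      insert b (ancSet f 0 b) \ ancSet f 0 (b + 1) := by
    intro a
    simp only [Finset.mem_sdiff, Finset.mem_insert, mem_ancSet]
    omega
  -- If the window keeps no ancestor of `b + 1`, all its `anc f s b + 1` candidates were popped and
  -- truncated subtraction gives `0`. Otherwise a surviving `x` in the window forces every candidate
  -- to the left of `s` to survive, so every pop happens inside the window.
  rcases (ancSet f s (b + 1)).eq_empty_or_nonempty with he | ⟨x, hx⟩
  · have h1 : anc f s (b + 1) = 0 := by simp [anc, he]
    have h2 := Finset.card_le_card hsub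
    have h3 : (ancSet f s (b + 1)).card = 0 := h1
    omega
  · have heq : insert b (ancSet f 0 b) \ ancSet f 0 (b + 1) ⊆
        insert b (ancSet f s b) \ ancSet f s (b + 1) := by
      intro a
      simp only [Finset.mem_sdiff, Finset.mem_insert, mem_ancSet] at hx ⊢
      rintro ⟨h1, h2⟩
      have hsa : s ≤ a := by
        by_contra hlt
        have hax : a < x := by omega
        have hab : f a < f b := by omega
        have : f a < f x := by
          rcases eq_or_ne x b with rfl | hxb
          · exact hab
          · exact hf a x b hax (by omega) (by omega) hab
        omega
      omega
    have := congrArg Finset.card (Finset.Subset.antisymm heq hsub)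
    have h3 : (ancSet f s (b + 1)).card = anc f s (b + 1) := rfl
    omega

theorem ancSet_eq_insert {f : ℕ → ℕ} {s b : ℕ} (hs : s < b) (h : f s < f b) :
    anc f s b = anc f (s + 1) b + 1 := by
  have : ancSet f s b = insert s (ancSet f (s + 1) b) := by
    ext a
    simp only [Finset.mem_insert, mem_ancSet]
    constructor
    · intro h
      omega
    · rintro (rfl | h') <;> omega
  unfold anc
  rw [this, Finset.card_insert_of_notMem (by simp [mem_ancSet])]

theorem ancSet_eq_of_not {f : ℕ → ℕ} {s b : ℕ} (h : ¬ f s < f b) :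
    anc f s b = anc f (s + 1) b := by
  have : ancSet f s b = ancSet f (s + 1) b := by
    ext a
    simp only [mem_ancSet]
    constructor
    · intro h'
      rcases eq_or_ne a s with rfl | hne
      · omega
      · omega
    · intro h'
      omega
  unfold anc
  rw [this]

/-- The windows starting at `s` and `s + 1` differ only in the vertex `s`, so window counts recover
the order. -/
theorem lt_iff_anc {f : ℕ → ℕ} {s b : ℕ} (hs : s < b) :
    f s < f b ↔ anc f (s + 1) b < anc f s b := by
  by_cases h : f s < f b
  · rw [ancSet_eq_insert hs h]; simpa
  · rw [ancSet_eq_of_not h]; simpa using h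

/-- Equal descents give equal order relations. -/
theorem anc_congr_of_descent {f g : ℕ → ℕ} {n : ℕ} (hf : AvoidsUpTo f n) (hg : AvoidsUpTo g n)
    (h : ∀ i < n, descent f i = descent g i) (s b : ℕ) (hs : s ≤ b) (hb : b ≤ n) :
    anc f s b = anc g s b := by
  induction b, hs using Nat.le_induction with
  | base => simp
  | succ b hs ih =>
    rw [anc_succ hf (by omega) hs, anc_succ hg (by omega) hs, ih (by omega), h b (by omega)]

theorem lt_iff_of_descent {f g : ℕ → ℕ} {n : ℕ} (hf : AvoidsUpTo f n) (hg : AvoidsUpTo g n)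
    (h : ∀ i < n, descent f i = descent g i) (a b : ℕ) (hab : a < b) (hb : b ≤ n) :
    f a < f b ↔ g a < g b := by
  rw [lt_iff_anc hab, lt_iff_anc hab, anc_congr_of_descent hf hg h _ _ (by omega) hb,
    anc_congr_of_descent hf hg h _ _ (by omega) hb]

theorem anc_eq_iff_lt_iff {f g : ℕ → ℕ} {n : ℕ} (hf : AvoidsUpTo f n) (hg : AvoidsUpTo g n) :
    (∀ i ≤ n, anc f 0 i = anc g 0 i) ↔ ∀ a b, a < b → b ≤ n → (f a < f b ↔ g a < g b) := by
  constructor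
  · intro h
    refine lt_iff_of_descent hf hg fun i hi => ?_
    rw [descent, descent, h i (by omega), h (i + 1) (by omega)]
  · intro h i hi
    unfold anc
    congr 1
    ext a
    simp only [mem_ancSet]
    constructor
    · intro h'
      have := h a i (by omega) hi
      omega
    · intro h'
      have := h a i (by omega) hi
      omega

/-- The covering relation of the plot of `f`. -/
def Covers (f : ℕ → ℕ) (a b : ℕ) : Prop :=
  a < b ∧ f a < f b ∧ ¬ ∃ l, a < l ∧ l < b ∧ f a < f l ∧ f l < f b

/-- Induction on the gap: a comparable pair that is not a cover splits at an intermediate point. -/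
theorem lt_of_covers_imp {f g : ℕ → ℕ} {n : ℕ}
    (h : ∀ a b, a < b → b < n → Covers f a b → Covers g a b) (N : ℕ) :
    ∀ a b, b - a ≤ N → a < b → b < n → f a < f b → g a < g b := by
  induction N with
  | zero => intro a b h1 h2; omega
  | succ N ih =>
    intro a b h1 hab hb hlt
    by_cases hl : ∃ l, a < l ∧ l < b ∧ f a < f l ∧ f l < f b
    · obtain ⟨l, h2, h3, h4, h5⟩ := hl
      exact (ih a l (by omega) h2 (by omega) h4).trans (ih l b (by omega) h3 hb h5)
    · exact (h a b hab hb ⟨hab, hlt, hl⟩).2.1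

theorem covers_iff_iff_lt_iff {f g : ℕ → ℕ} {n : ℕ} :
    (∀ a b, a < b → b < n → (Covers f a b ↔ Covers g a b)) ↔
      ∀ a b, a < b → b < n → (f a < f b ↔ g a < g b) := by
  constructor
  · intro h a b hab hb
    exact ⟨lt_of_covers_imp (fun a b h1 h2 => (h a b h1 h2).1) _ a b le_rfl hab hb,
      lt_of_covers_imp (fun a b h1 h2 => (h a b h1 h2).2) _ a b le_rfl hab hb⟩
  · intro h a b hab hb
    unfold Covers
    rw [h a b hab hb]
    refine and_congr_right fun _ => and_congr_right fun _ => not_congr <| exists_congr fun l => ?_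
    refine and_congr_right fun h1 => and_congr_right fun h2 => ?_
    rw [h a l h1 (by omega), h l b h2 hb]

/-- The sum telescopes, since by `anc_succ_le` the subtraction in `descent` never truncates. -/
theorem sum_descent {f : ℕ → ℕ} {n : ℕ} (hf : AvoidsUpTo f n) :
    ∑ i ∈ Finset.range n, descent f i + anc f 0 n = n := by
  have : ∀ j ≤ n, ∑ i ∈ Finset.range j, descent f i + anc f 0 j = j := by
    intro j hj
    induction j with
    | zero => simp
    | succ j ih =>
      rw [Finset.sum_range_succ]
      have h1 := anc_succ_le (s := 0) hf (show j < n by omega)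
      have h2 := ih (by omega)
      unfold descent at h2 ⊢
      omega
  exact this n le_rfl

namespace PlaneForest

/-! ### The permutation of a plane forest -/

/-- The values of the `213`-avoiding permutation of a plane forest (`0` beyond its size). -/
def val : PlaneForest → ℕ → ℕ
  | nil, _ => 0
  | cons c r, i =>
      if i = 0 then r.size else
        if i < 1 + c.size then r.size + 1 + c.val (i - 1) else r.val (i - (1 + c.size))

theorem val_cons_zero (c r : PlaneForest) : (cons c r).val 0 = r.size := by simp [val]

theorem val_cons_left (c r : PlaneForest) {i : ℕ} (hi : i < c.size) :
    (cons c r).val (1 + i) = r.size + 1 + c.val i := by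
  simp [val, hi]

theorem val_cons_right (c r : PlaneForest) (i : ℕ) :
    (cons c r).val (1 + c.size + i) = r.val i := by
  simp only [val]
  rw [if_neg (by omega), if_neg (by omega)]
  congr 1
  omega

/-- Every position in `cons c r` is the root, in `c`, or in `r` (or beyond). -/
theorem cases_cons (c : PlaneForest) (i : ℕ) :
    i = 0 ∨ (∃ j, j < c.size ∧ i = 1 + j) ∨ ∃ j, i = 1 + c.size + j := by
  rcases Nat.eq_zero_or_pos i with h | h
  · exact Or.inl h
  · by_cases h' : i < 1 + c.size
    · exact Or.inr (Or.inl ⟨i - 1, by omega, by omega⟩)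
    · exact Or.inr (Or.inr ⟨i - (1 + c.size), by omega⟩)

theorem val_lt (F : PlaneForest) : ∀ i < F.size, F.val i < F.size := by
  induction F with
  | nil => intro i hi; simp [size] at hi
  | cons c r ihc ihr =>
    intro i hi
    rcases cases_cons c i with rfl | ⟨j, hj, rfl⟩ | ⟨j, rfl⟩
    · rw [val_cons_zero]; simp only [size]; omega
    · rw [val_cons_left c r hj]; have := ihc j hj; simp only [size]; omega
    · rw [val_cons_right]
      simp only [size] at hi ⊢
      have := ihr j (by omega)
      omega

theorem val_of_size_le (F : PlaneForest) : ∀ i, F.size ≤ i → F.val i = 0 := by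
  induction F with
  | nil => intro i _; rfl
  | cons c r ihc ihr =>
    intro i hi
    simp only [size] at hi
    rcases cases_cons c i with rfl | ⟨j, hj, rfl⟩ | ⟨j, rfl⟩
    · omega
    · omega
    · rw [val_cons_right]; exact ihr j (by omega)

theorem val_lt_or (F : PlaneForest) (i : ℕ) : F.val i < F.size ∨ F.val i = 0 := by
  by_cases h : i < F.size
  · exact Or.inl (F.val_lt i h)
  · exact Or.inr (F.val_of_size_le i (by omega))

theorem val_injOn (F : PlaneForest) : ∀ i < F.size, ∀ j < F.size, F.val i = F.val j → i = j := by
  induction F with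
  | nil => intro i hi; simp [size] at hi
  | cons c r ihc ihr =>
    intro i hi j hj
    rcases cases_cons c i with rfl | ⟨i, hi', rfl⟩ | ⟨i, rfl⟩ <;>
    rcases cases_cons c j with rfl | ⟨j, hj', rfl⟩ | ⟨j, rfl⟩ <;>
    simp only [size] at hi hj <;>
    (try rw [val_cons_zero]) <;> (try rw [val_cons_left c r hi']) <;>
    (try rw [val_cons_left c r hj']) <;> (try rw [val_cons_right]) <;> (try rw [val_cons_right]) <;>
    intro h
    · rfl
    · omega
    · have := r.val_lt j (by omega); omega
    · omega
    · have := ihc i hi' j hj' (by omega); omega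
    · have := r.val_lt j (by omega); omega
    · have := r.val_lt i (by omega); omega
    · have := r.val_lt i (by omega); omega
    · have := ihr i (by omega) j (by omega) h; omega

/-- The first tree lies above all later ones, with its root below its other vertices. An increasing
pair therefore stays within the first tree or within the rest. The default value `0` is never the
top of such a pair, so no bound on `c` is needed. -/
theorem val_avoids (F : PlaneForest) : ∀ a b c, a < b → b < c → F.val a < F.val c →
    F.val a < F.val b := by
  induction F with
  | nil => intro a b c _ _ h; simp [val] at h
  | cons c r ihc ihr =>
    intro i j k hij hjk
    rcases cases_cons c i with rfl | ⟨i, hi', rfl⟩ | ⟨i, rfl⟩ <;>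
    rcases cases_cons c j with rfl | ⟨j, hj', rfl⟩ | ⟨j, rfl⟩ <;>
    rcases cases_cons c k with rfl | ⟨k, hk', rfl⟩ | ⟨k, rfl⟩ <;>
    (try (exfalso; omega)) <;>
    (try rw [val_cons_zero]) <;> (try rw [val_cons_left c r hi']) <;>
    (try rw [val_cons_left c r hj']) <;> (try rw [val_cons_left c r hk']) <;>
    (try simp only [val_cons_right]) <;>
    intro h
    · omega
    · omega
    · rcases r.val_lt_or k with h' | h' <;> omega
    · have := ihc i j k (by omega) (by omega) (by omega); omega
    · rcases r.val_lt_or k with h' | h' <;> omega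
    · rcases r.val_lt_or k with h' | h' <;> omega
    · exact ihr i j k (by omega) (by omega) h

theorem val_avoidsUpTo (F : PlaneForest) (n : ℕ) : AvoidsUpTo F.val n :=
  fun a b c h1 h2 _ h => F.val_avoids a b c h1 h2 h

/-- The first value is the size of the rest, so it reveals where the first tree ends. -/
theorem eq_of_val_eq (F : PlaneForest) : ∀ G : PlaneForest, F.size = G.size →
    (∀ i < F.size, F.val i = G.val i) → F = G := by
  induction F with
  | nil =>
    intro G hs _
    cases G with
    | nil => rfl
    | cons c r => simp only [size] at hs; omega
  | cons c r ihc ihr =>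
    intro G hs h
    cases G with
    | nil => simp only [size] at hs; omega
    | cons c' r' =>
      have h0 := h 0 (by simp only [size]; omega)
      rw [val_cons_zero, val_cons_zero] at h0
      have hc : c.size = c'.size := by simp only [size] at hs; omega
      rw [ihc c' hc fun i hi => ?_, ihr r' h0 fun i hi => ?_]
      · have := h (1 + c.size + i) (by simp only [size]; omega)
        rwa [val_cons_right, hc, val_cons_right] at this
      · have := h (1 + i) (by simp only [size]; omega)
        rw [val_cons_left c r hi, val_cons_left c' r' (hc ▸ hi)] at this
        omega

/-! ### Roots, children and depths read off from the permutation of a plane forest. -/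

theorem isRoot_lt_size (F : PlaneForest) : ∀ b, F.IsRoot b → b < F.size := by
  induction F with
  | nil => intro b h; exact h.elim
  | cons c r _ ihr =>
    rintro b (rfl | ⟨b', rfl, h⟩)
    · simp only [size]; omega
    · have := ihr b' h; simp only [size]; omega

theorem isChild_lt (F : PlaneForest) : ∀ a b, F.IsChild a b → a < b ∧ b < F.size := by
  induction F with
  | nil => intro a b h; exact h.elim
  | cons c r ihc ihr =>
    rintro a b (⟨rfl, b', rfl, h⟩ | ⟨a', b', rfl, rfl, h⟩ | ⟨a', b', rfl, rfl, h⟩)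
    · have := c.isRoot_lt_size _ h; simp only [size]; omega
    · have := ihc _ _ h; simp only [size]; omega
    · have := ihr _ _ h; simp only [size]; omega

theorem isRoot_iff (F : PlaneForest) : ∀ b < F.size,
    (F.IsRoot b ↔ ∀ a < b, ¬ F.val a < F.val b) := by
  induction F with
  | nil => intro b hb; simp [size] at hb
  | cons c r ihc ihr =>
    intro b hb
    simp only [IsRoot]
    rcases cases_cons c b with rfl | ⟨b, hb', rfl⟩ | ⟨b, rfl⟩
    · simp
    · constructor
      · rintro (h | ⟨b', h, -⟩) <;> omega
      · intro h
        have := h 0 (by omega)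
        rw [val_cons_zero, val_cons_left c r hb'] at this
        omega
    · simp only [size] at hb
      have hb2 := r.val_lt b (by omega)
      have : (1 + c.size + b = 0 ∨ ∃ b', 1 + c.size + b = 1 + c.size + b' ∧ r.IsRoot b') ↔
          r.IsRoot b := by
        constructor
        · rintro (h | ⟨b', h, h'⟩)
          · omega
          · obtain rfl : b = b' := by omega
            exact h'
        · exact fun h => Or.inr ⟨b, rfl, h⟩
      rw [this, ihr b (by omega)]
      constructor
      · intro h a ha
        rw [val_cons_right]
        rcases cases_cons c a with rfl | ⟨a, ha', rfl⟩ | ⟨a, rfl⟩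
        · rw [val_cons_zero]; omega
        · rw [val_cons_left c r ha']; omega
        · rw [val_cons_right]; exact h a (by omega)
      · intro h a ha
        have := h (1 + c.size + a) (by omega)
        rwa [val_cons_right, val_cons_right] at this

/-- Two vertices in the same block have only vertices of that block between them, so recursion
applies. Between the first root and a vertex of its tree only that tree intervenes, and covers of
the root are the roots of `c` by `isRoot_iff`. Pairs from the first tree to the rest decrease. -/
theorem isChild_iff_covers (F : PlaneForest) : ∀ a b, b < F.size →
    (F.IsChild a b ↔ Covers F.val a b) := by
  induction F with
  | nil => intro a b hb; simp [size] at hb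
  | cons c r ihc ihr =>
    intro a b hb
    simp only [IsChild]
    rcases cases_cons c b with rfl | ⟨b, hb', rfl⟩ | ⟨b, rfl⟩
    · simp only [Covers, Nat.not_lt_zero, false_and, iff_false]
      rintro (⟨_, b', h, -⟩ | ⟨_, b', _, h, -⟩ | ⟨_, b', _, h, -⟩) <;> omega
    · rcases cases_cons c a with rfl | ⟨a, ha', rfl⟩ | ⟨a, rfl⟩
      · have h1 : ((0 = 0 ∧ ∃ b', 1 + b = 1 + b' ∧ c.IsRoot b') ∨
            (∃ a' b', 0 = 1 + a' ∧ 1 + b = 1 + b' ∧ c.IsChild a' b') ∨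
            (∃ a' b', 0 = 1 + c.size + a' ∧ 1 + b = 1 + c.size + b' ∧ r.IsChild a' b')) ↔
            c.IsRoot b := by
          constructor
          · rintro (⟨_, b', h, h'⟩ | ⟨_, b', h, -⟩ | ⟨_, b', h, -⟩)
            · obtain rfl : b = b' := by omega
              exact h'
            · omega
            · omega
          · exact fun h => Or.inl ⟨rfl, b, rfl, h⟩
        rw [h1, c.isRoot_iff b hb']
        unfold Covers
        rw [val_cons_zero, val_cons_left c r hb']
        constructor
        · refine fun h => ⟨by omega, by omega, ?_⟩
          rintro ⟨l, hl, hlb, h2, h3⟩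
          obtain ⟨l, rfl⟩ : ∃ l', l = 1 + l' := ⟨l - 1, by omega⟩
          rw [val_cons_left c r (by omega)] at h2 h3
          exact h l (by omega) (by omega)
        · rintro ⟨_, _, h⟩ a ha hlt
          refine h ⟨1 + a, by omega, by omega, ?_, ?_⟩ <;> rw [val_cons_left c r (by omega)] <;> omega
      · have h1 : ((1 + a = 0 ∧ ∃ b', 1 + b = 1 + b' ∧ c.IsRoot b') ∨
            (∃ a' b', 1 + a = 1 + a' ∧ 1 + b = 1 + b' ∧ c.IsChild a' b') ∨
            (∃ a' b', 1 + a = 1 + c.size + a' ∧ 1 + b = 1 + c.size + b' ∧ r.IsChild a' b')) ↔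
            c.IsChild a b := by
          constructor
          · rintro (⟨h, -⟩ | ⟨a', b', h, h', h''⟩ | ⟨_, b', h, -⟩)
            · omega
            · obtain rfl : b = b' := by omega
              obtain rfl : a = a' := by omega
              exact h''
            · omega
          · exact fun h => Or.inr (Or.inl ⟨a, b, rfl, rfl, h⟩)
        rw [h1, ihc a b hb']
        unfold Covers
        rw [val_cons_left c r ha', val_cons_left c r hb']
        constructor
        · rintro ⟨h1, h2, h⟩
          refine ⟨by omega, by omega, ?_⟩
          rintro ⟨l, hl, hlb, h2, h3⟩
          obtain ⟨l, rfl⟩ : ∃ l', l = 1 + l' := ⟨l - 1, by omega⟩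
          rw [val_cons_left c r (by omega)] at h2 h3
          exact h ⟨l, by omega, by omega, by omega, by omega⟩
        · rintro ⟨h1, h2, h⟩
          refine ⟨by omega, by omega, ?_⟩
          rintro ⟨l, hl, hlb, h2, h3⟩
          refine h ⟨1 + l, by omega, by omega, ?_, ?_⟩ <;> rw [val_cons_left c r (by omega)] <;> omega
      · constructor
        · rintro (⟨h, -⟩ | ⟨a', b', h, h', h''⟩ | ⟨_, b', h, h', -⟩)
          · omega
          · have := c.isChild_lt _ _ h''; omega
          · omega
        · rintro ⟨h, -⟩; omega
    · simp only [size] at hb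
      have hb2 := r.val_lt b (by omega)
      have h1 : ((a = 0 ∧ ∃ b', 1 + c.size + b = 1 + b' ∧ c.IsRoot b') ∨
            (∃ a' b', a = 1 + a' ∧ 1 + c.size + b = 1 + b' ∧ c.IsChild a' b') ∨
            (∃ a' b', a = 1 + c.size + a' ∧ 1 + c.size + b = 1 + c.size + b' ∧ r.IsChild a' b')) ↔
            ∃ a', a = 1 + c.size + a' ∧ r.IsChild a' b := by
        constructor
        · rintro (⟨_, b', h, h'⟩ | ⟨_, b', _, h, h'⟩ | ⟨a', b', h, h', h''⟩)
          · have := c.isRoot_lt_size _ h'; omega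
          · have := c.isChild_lt _ _ h'; omega
          · obtain rfl : b = b' := by omega
            exact ⟨a', h, h''⟩
        · rintro ⟨a', h, h'⟩
          exact Or.inr (Or.inr ⟨a', b, h, rfl, h'⟩)
      rw [h1]
      rcases cases_cons c a with rfl | ⟨a, ha', rfl⟩ | ⟨a, rfl⟩
      · unfold Covers
        rw [val_cons_zero, val_cons_right]
        constructor
        · rintro ⟨a', h, -⟩; omega
        · rintro ⟨_, h, -⟩; omega
      · unfold Covers
        rw [val_cons_left c r ha', val_cons_right]
        constructor
        · rintro ⟨a', h, -⟩; omega
        · rintro ⟨_, h, -⟩; omega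
      · have h2 : (∃ a', 1 + c.size + a = 1 + c.size + a' ∧ r.IsChild a' b) ↔ r.IsChild a b := by
          constructor
          · rintro ⟨a', h, h'⟩
            obtain rfl : a = a' := by omega
            exact h'
          · exact fun h => ⟨a, rfl, h⟩
        rw [h2, ihr a b (by omega)]
        unfold Covers
        rw [val_cons_right, val_cons_right]
        constructor
        · rintro ⟨h1, h2, h⟩
          refine ⟨by omega, by omega, ?_⟩
          rintro ⟨l, hl, hlb, h2, h3⟩
          obtain ⟨l, rfl⟩ : ∃ l', l = 1 + c.size + l' := ⟨l - (1 + c.size), by omega⟩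
          rw [val_cons_right] at h2 h3
          exact h ⟨l, by omega, by omega, by omega, by omega⟩
        · rintro ⟨h1, h2, h⟩
          refine ⟨by omega, by omega, ?_⟩
          rintro ⟨l, hl, hlb, h2, h3⟩
          refine h ⟨1 + c.size + l, by omega, by omega, ?_, ?_⟩ <;> rw [val_cons_right] <;> omega

/-- The number of ancestors of a vertex of a plane forest (`0` beyond its size). -/
def depth (F : PlaneForest) (i : ℕ) : ℕ := anc F.val 0 i

/-- The default value `0` makes position `size` a phantom vertex with nothing below it; it models
the vertex just to the right of the fringe. -/
theorem depth_size (F : PlaneForest) : F.depth F.size = 0 := by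
  simp [depth, anc, ancSet, F.val_of_size_le F.size le_rfl]

theorem depth_eq_zero_iff (F : PlaneForest) {i : ℕ} (hi : i < F.size) :
    F.depth i = 0 ↔ F.IsRoot i := by
  rw [F.isRoot_iff i hi, depth, anc, Finset.card_eq_zero, Finset.eq_empty_iff_forall_notMem]
  simp only [mem_ancSet]
  exact ⟨fun h a ha hlt => h a ⟨⟨by omega, ha⟩, hlt⟩, fun h a ha => h a ha.1.2 ha.2⟩

open Classical in
theorem card_isRoot (F : PlaneForest) :
    ((Finset.range F.size).filter fun i => F.IsRoot i).card = F.numTrees := by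
  induction F with
  | nil => simp [size, numTrees]
  | cons c r _ ihr =>
    have : (Finset.range (cons c r).size).filter (fun i => (cons c r).IsRoot i) =
        insert 0 (((Finset.range r.size).filter fun i => r.IsRoot i).map
          (addLeftEmbedding (1 + c.size))) := by
      ext b
      rw [Finset.mem_filter, Finset.mem_insert, Finset.mem_map]
      simp only [Finset.mem_filter, Finset.mem_range, IsRoot, addLeftEmbedding_apply, size]
      constructor
      · rintro ⟨_, rfl | ⟨b', rfl, h⟩⟩
        · exact Or.inl rfl
        · exact Or.inr ⟨b', ⟨by omega, h⟩, rfl⟩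
      · rintro (rfl | ⟨b', ⟨h, h'⟩, rfl⟩)
        · exact ⟨by omega, Or.inl rfl⟩
        · exact ⟨by omega, Or.inr ⟨b', rfl, h'⟩⟩
    rw [this, Finset.card_insert_of_notMem, Finset.card_map, ihr, numTrees, add_comm]
    simp

end PlaneForest

/-! ### Windows in a sequence of independent geometric variables -/

theorem half_ne_zero_unitInterval : (⟨1 / 2, by norm_num, by norm_num⟩ : unitInterval) ≠ 0 := by
  intro h
  have := congrArg Subtype.val h
  norm_num at this

/-- The geometric law with `j ↦ 2⁻¹⁻ʲ`. -/
noncomputable def halfGeometric : Measure ℕ :=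
  geometricMeasure ⟨1 / 2, by norm_num, by norm_num⟩

instance : IsProbabilityMeasure halfGeometric := by
  unfold halfGeometric; infer_instance

/-- The law of a sequence of independent geometric variables. -/
noncomputable def geometricSequence : Measure (ℕ → ℕ) :=
  Measure.infinitePi fun _ => halfGeometric

instance : IsProbabilityMeasure geometricSequence := by
  unfold geometricSequence; infer_instance

theorem halfGeometric_real_singleton (n : ℕ) : halfGeometric.real {n} = (1 / 2) ^ (n + 1) := by
  rw [halfGeometric, geometricMeasure_real_singleton half_ne_zero_unitInterval, pow_succ]
  norm_num

theorem halfGeometric_real_Ici (n : ℕ) : halfGeometric.real (Set.Ici n) = (1 / 2) ^ n := by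
  induction n with
  | zero =>
    have : Set.Ici 0 = (Set.univ : Set ℕ) := by ext; simp
    rw [this]; simp
  | succ n ih =>
    have : Set.Ici n = Set.Ici (n + 1) ∪ {n} := by
      ext x
      simp only [Set.mem_Ici, Set.mem_union, Set.mem_singleton_iff]
      omega
    rw [this, measureReal_union (by simp) (by simp), halfGeometric_real_singleton] at ih
    rw [pow_succ] at ih ⊢
    linarith

/-- The probability of a given truncated step. -/
theorem halfGeometric_real_step {a b : ℕ} (h : b ≤ a + 1) :
    halfGeometric.real {d | a + 1 - d = b} =
      (1 / 2) ^ (a + 1 - b) * if b = 0 then 1 else 1 / 2 := by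
  split_ifs with hb
  · have : {d | a + 1 - d = b} = Set.Ici (a + 1) := by
      ext d; simp only [Set.mem_ofPred_eq, Set.mem_Ici]; omega
    rw [this, halfGeometric_real_Ici, hb]
    simp
  · have : {d | a + 1 - d = b} = {a + 1 - b} := by
      ext d; simp only [Set.mem_ofPred_eq, Set.mem_singleton_iff]; omega
    rw [this, halfGeometric_real_singleton, pow_succ]

/-- The sequences whose window of length `m` at `p` has entries in the sets `A 0, …, A (m - 1)`. -/
def windowEvent (A : ℕ → Set ℕ) (m p : ℕ) : Set (ℕ → ℕ) := {x | ∀ i < m, x (p + i) ∈ A i}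

theorem measurableSet_windowEvent (A : ℕ → Set ℕ) (m p : ℕ) :
    MeasurableSet (windowEvent A m p) := by
  have : windowEvent A m p = ⋂ i ∈ Finset.range m, (fun x : ℕ → ℕ => x (p + i)) ⁻¹' A i := by
    ext x; simp [windowEvent]
  rw [this]
  exact Finset.measurableSet_biInter _ fun i _ =>
    measurable_pi_apply _ (MeasurableSet.of_discrete)

theorem measure_biInter_windowEvent (A : ℕ → Set ℕ) {m M : ℕ} (hm : m < M) (r : ℕ)
    (S : Finset ℕ) :
    geometricSequence (⋂ j ∈ S, windowEvent A m (r + M * j)) =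
      ∏ _j ∈ S, ∏ i ∈ Finset.range m, halfGeometric (A i) := by
  have hmod : ∀ j i, i < m → (r + M * j + i - r) % M = i := by
    intro j i hi
    have : r + M * j + i - r = i + M * j := by omega
    rw [this, Nat.add_mul_mod_self_left, Nat.mod_eq_of_lt (by omega)]
  -- Since `m < M` the windows are disjoint, and a coordinate in their union determines its offset
  -- modulo `M`; the intersection is thus a single cylinder.
  set U := (S ×ˢ Finset.range m).image fun q : ℕ × ℕ => r + M * q.1 + q.2 with hU
  have : (⋂ j ∈ S, windowEvent A m (r + M * j)) =
      Set.pi (U : Set ℕ) fun k => A ((k - r) % M) := by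
    ext x
    simp only [Set.mem_iInter, windowEvent, Set.mem_ofPred_eq, Set.mem_pi, Finset.mem_coe, hU,
      Finset.mem_image, Finset.mem_product, Finset.mem_range, Prod.exists]
    constructor
    · rintro h k ⟨j, i, ⟨hj, hi⟩, rfl⟩
      rw [hmod j i hi]
      exact h j hj i hi
    · intro h j hj i hi
      have := h _ ⟨j, i, ⟨hj, hi⟩, rfl⟩
      rwa [hmod j i hi] at this
  rw [this, geometricSequence, Measure.infinitePi_pi _ (fun _ _ => MeasurableSet.of_discrete), hU,
    Finset.prod_image, Finset.prod_product]
  · refine Finset.prod_congr rfl fun j _ => Finset.prod_congr rfl fun i hi => ?_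
    rw [hmod j i (Finset.mem_range.1 hi)]
  · rintro ⟨j, i⟩ h1 ⟨j', i'⟩ h2 h
    simp only [Finset.coe_product, Set.mem_prod, Finset.mem_coe, Finset.mem_range] at h1 h2 h
    have hi : i = i' := by
      rw [← hmod j i h1.2, ← hmod j' i' h2.2, h]
    subst hi
    have : M * j = M * j' := by omega
    rw [Nat.eq_of_mul_eq_mul_left (by omega) this]

theorem measure_windowEvent (A : ℕ → Set ℕ) (m p : ℕ) :
    geometricSequence (windowEvent A m p) = ∏ i ∈ Finset.range m, halfGeometric (A i) := by
  simpa using measure_biInter_windowEvent A (Nat.lt_succ_self m) p {0}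

theorem iIndepSet_windowEvent (A : ℕ → Set ℕ) {m M : ℕ} (hm : m < M) (r : ℕ) :
    iIndepSet (fun j => windowEvent A m (r + M * j)) geometricSequence := by
  rw [iIndepSet_iff_meas_biInter fun j => measurableSet_windowEvent _ _ _]
  intro S
  rw [measure_biInter_windowEvent A hm]
  exact Finset.prod_congr rfl fun j _ => (measure_windowEvent A m _).symm

/-- The centred indicator of a window event. -/
noncomputable def windowDeviation (A : ℕ → Set ℕ) (m p : ℕ) (x : ℕ → ℕ) : ℝ :=
  (windowEvent A m p).indicator 1 x - ∏ i ∈ Finset.range m, halfGeometric.real (A i)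

theorem integral_indicator_windowEvent (A : ℕ → Set ℕ) (m p : ℕ) :
    ∫ x, (windowEvent A m p).indicator (1 : (ℕ → ℕ) → ℝ) x ∂geometricSequence =
      ∏ i ∈ Finset.range m, halfGeometric.real (A i) := by
  rw [integral_indicator_one (measurableSet_windowEvent _ _ _), measureReal_def,
    measure_windowEvent, ENNReal.toReal_prod]
  rfl

/-- Hoeffding's lemma for a variable in `[0, 1]`: the parameter is `((1 - 0) / 2) ^ 2`. -/
theorem hasSubgaussianMGF_windowDeviation (A : ℕ → Set ℕ) (m p : ℕ) :
    HasSubgaussianMGF (windowDeviation A m p) (1 / 4) geometricSequence := by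
  have h := hasSubgaussianMGF_of_mem_Icc (μ := geometricSequence)
    (X := (windowEvent A m p).indicator (1 : (ℕ → ℕ) → ℝ)) (a := 0) (b := 1)
    ((measurable_one.indicator (measurableSet_windowEvent _ _ _)).aemeasurable)
    (Eventually.of_forall fun x => ?_)
  · rw [integral_indicator_windowEvent] at h
    have h2 : ((‖(1 : ℝ) - 0‖₊ / 2) ^ 2 : NNReal) = 1 / 4 := by
      rw [sub_zero, nnnorm_one, div_pow]; norm_num
    rw [h2] at h
    exact h
  · by_cases hx : x ∈ windowEvent A m p <;> simp [hx]

theorem iIndepFun_windowDeviation (A : ℕ → Set ℕ) {m M : ℕ} (hm : m < M) (r : ℕ) :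
    iIndepFun (fun j => windowDeviation A m (r + M * j)) geometricSequence :=
  (iIndepSet_windowEvent A hm r).iIndepFun_indicator (β := ℝ) |>.comp
    (fun _ y => y - ∏ i ∈ Finset.range m, halfGeometric.real (A i)) (fun _ => by fun_prop)

theorem measure_abs_sum_progression_ge_le (A : ℕ → Set ℕ) {m M N : ℕ} (hm : m < M) (r : ℕ)
    (S : Finset ℕ) (hS : S.card ≤ N) {ε : ℝ} (hε : 0 < ε) :
    geometricSequence.real {x | ε ≤ |∑ j ∈ S, windowDeviation A m (r + M * j) x|} ≤
      2 * Real.exp (-(2 * ε ^ 2 / N)) := by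
  rcases S.eq_empty_or_nonempty with rfl | hne
  · simp only [Finset.sum_empty, abs_zero, not_le.2 hε, Set.ofPred_false, measureReal_empty]
    positivity
  have hpos : (0 : ℝ) < S.card := by exact_mod_cast hne.card_pos
  have hSN : (S.card : ℝ) ≤ N := by exact_mod_cast hS
  have hexp : Real.exp (-ε ^ 2 / (2 * ∑ _j ∈ S, ((1 / 4 : NNReal) : ℝ))) ≤
      Real.exp (-(2 * ε ^ 2 / N)) := by
    apply Real.exp_le_exp.2
    rw [Finset.sum_const, nsmul_eq_mul, neg_div, neg_le_neg_iff]
    have : 2 * ((S.card : ℝ) * ((1 / 4 : NNReal) : ℝ)) = S.card / 2 := by push_cast; ring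
    rw [this, div_div_eq_mul_div, mul_comm]
    gcongr
  have h1 := HasSubgaussianMGF.measure_sum_ge_le_of_iIndepFun (iIndepFun_windowDeviation A hm r)
    (s := S) (fun j _ => hasSubgaussianMGF_windowDeviation A m _) hε.le
  have h2 := HasSubgaussianMGF.measure_sum_ge_le_of_iIndepFun
    ((iIndepFun_windowDeviation A hm r).comp (fun _ y => -y) (fun _ => measurable_neg))
    (s := S) (fun j _ => (hasSubgaussianMGF_windowDeviation A m _).neg) hε.le
  push_cast at h1 h2 hexp
  have hsub : {x | ε ≤ |∑ j ∈ S, windowDeviation A m (r + M * j) x|} ⊆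
      {x | ε ≤ ∑ j ∈ S, windowDeviation A m (r + M * j) x} ∪
      {x | ε ≤ ∑ j ∈ S, ((fun y : ℝ => -y) ∘ windowDeviation A m (r + M * j)) x} := by
    intro x hx
    simp only [Set.mem_ofPred_eq, Set.mem_union, Function.comp_apply, Finset.sum_neg_distrib] at hx ⊢
    exact le_abs.1 hx
  calc _ ≤ _ := measureReal_mono hsub (measure_ne_top _ _)
    _ ≤ _ := measureReal_union_le _ _
    _ ≤ _ := by linarith [h1.trans hexp, h2.trans hexp]

theorem sum_range_eq_sum_progressions (a : ℕ → ℝ) {M : ℕ} (hM : 0 < M) (N : ℕ) :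
    ∑ s ∈ Finset.range N, a s = ∑ r ∈ Finset.range M,
      ∑ j ∈ (Finset.range N).filter (fun j => r + M * j < N), a (r + M * j) := by
  rw [Finset.sum_sigma']
  refine Finset.sum_bij' (fun s _ => ⟨s % M, s / M⟩) (fun q _ => q.1 + M * q.2) ?_ ?_ ?_ ?_ ?_
  · intro s hs
    simp only [Finset.mem_range, Finset.mem_sigma, Finset.mem_filter] at hs ⊢
    refine ⟨Nat.mod_lt _ hM, lt_of_le_of_lt (Nat.div_le_self _ _) hs, ?_⟩
    rwa [Nat.mod_add_div]
  · rintro ⟨r, j⟩ h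
    simp only [Finset.mem_range, Finset.mem_sigma, Finset.mem_filter] at h ⊢
    exact h.2.2
  · intro s _
    exact Nat.mod_add_div _ _
  · rintro ⟨r, j⟩ h
    simp only [Finset.mem_range, Finset.mem_sigma, Finset.mem_filter] at h
    have h1 : (r + M * j) % M = r := by rw [Nat.add_mul_mod_self_left, Nat.mod_eq_of_lt h.1]
    have h2 : (r + M * j) / M = j := by
      rw [Nat.add_mul_div_left _ _ hM, Nat.div_eq_of_lt h.1, zero_add]
    simp only [h1, h2]
  · intro s _
    simp only [Nat.mod_add_div]

/-- Exponential concentration of the number of occurrences of a window pattern. -/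
theorem measure_abs_sum_window_ge_le (A : ℕ → Set ℕ) (m N : ℕ) {δ : ℝ} (hδ : 0 < δ)
    (hN : 0 < N) :
    geometricSequence.real
      {x | δ * N ≤ |∑ s ∈ Finset.range N, windowDeviation A m (s + 1) x|} ≤
      2 * (m + 1) * Real.exp (-(2 * (δ / (m + 1)) ^ 2 * N)) := by
  have hN' : (0 : ℝ) < N := by exact_mod_cast hN
  have hm : (0 : ℝ) < m + 1 := by positivity
  set S : ℕ → Finset ℕ := fun r => (Finset.range N).filter (fun j => r + (m + 1) * j < N)
  -- A total deviation of `δ * N` leaves at least this share to one of the `m + 1` residue classes.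
  -- The modulus `m + 1` stays positive for the empty forest.
  set ε : ℝ := δ * N / (m + 1) with hε
  have hsub : {x | δ * N ≤ |∑ s ∈ Finset.range N, windowDeviation A m (s + 1) x|} ⊆
      ⋃ r ∈ Finset.range (m + 1),
        {x | ε ≤ |∑ j ∈ S r, windowDeviation A m (r + 1 + (m + 1) * j) x|} := by
    intro x hx
    by_contra hcon
    simp only [Set.mem_iUnion, Set.mem_ofPred_eq, not_exists, not_le] at hcon hx
    rw [sum_range_eq_sum_progressions _ (Nat.succ_pos m) N] at hx
    have h1 := Finset.abs_sum_le_sum_abs (fun r =>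
      ∑ j ∈ S r, windowDeviation A m (r + (m + 1) * j + 1) x) (Finset.range (m + 1))
    have h2 : ∑ r ∈ Finset.range (m + 1),
        |∑ j ∈ S r, windowDeviation A m (r + (m + 1) * j + 1) x| <
        ∑ r ∈ Finset.range (m + 1), ε := by
      refine Finset.sum_lt_sum_of_nonempty ⟨0, by simp⟩ fun r hr => ?_
      simpa only [add_right_comm] using hcon r hr
    rw [Finset.sum_const, Finset.card_range, nsmul_eq_mul, hε, Nat.cast_add, Nat.cast_one,
      mul_div_cancel₀ _ hm.ne'] at h2
    exact absurd (hx.trans h1) (not_le.2 h2)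
  calc _ ≤ _ := measureReal_mono hsub (measure_ne_top _ _)
    _ ≤ ∑ r ∈ Finset.range (m + 1), _ := measureReal_biUnion_finset_le _ _
    _ ≤ ∑ r ∈ Finset.range (m + 1), 2 * Real.exp (-(2 * ε ^ 2 / N)) :=
        Finset.sum_le_sum fun r _ => measure_abs_sum_progression_ge_le A (Nat.lt_succ_self m) (r + 1)
          (S r) ((Finset.card_filter_le _ _).trans (by simp)) (by positivity)
    _ = _ := by
      rw [Finset.sum_const, Finset.card_range, nsmul_eq_mul]
      have : 2 * ε ^ 2 / N = 2 * (δ / (m + 1)) ^ 2 * N := by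
        rw [hε]; field_simp
      rw [this]
      push_cast
      ring

/-- The sequences with a given beginning. -/
def prefixEvent (n : ℕ) (d : ℕ → ℕ) : Set (ℕ → ℕ) := {x | ∀ i < n, x i = d i}

theorem prefixEvent_eq (n : ℕ) (d : ℕ → ℕ) :
    prefixEvent n d = windowEvent (fun i => {d i}) n 0 := by
  ext x; simp [prefixEvent, windowEvent]

theorem le_measure_prefixEvent {n : ℕ} {d : ℕ → ℕ} (h : ∑ i ∈ Finset.range n, d i ≤ n) :
    (1 / 4 : ℝ) ^ n ≤ geometricSequence.real (prefixEvent n d) := by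
  rw [prefixEvent_eq, measureReal_def, measure_windowEvent, ENNReal.toReal_prod]
  change _ ≤ ∏ i ∈ Finset.range n, halfGeometric.real {d i}
  simp only [halfGeometric_real_singleton]
  rw [Finset.prod_pow_eq_pow_sum, Finset.sum_add_distrib]
  have h4 : (1 / 4 : ℝ) ^ n = (1 / 2) ^ (2 * n) := by rw [pow_mul]; norm_num
  rw [h4]
  apply pow_le_pow_of_le_one (by norm_num) (by norm_num)
  simp
  omega

/-- The probability of the window pattern of a plane forest. -/
theorem prod_halfGeometric_depth (F : PlaneForest) :
    ∏ i ∈ Finset.range F.size, halfGeometric.real {d | F.depth i + 1 - d = F.depth (i + 1)} =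
      1 / 2 ^ (2 * F.size - F.numTrees) := by
  classical
  have hle : ∀ i, F.depth (i + 1) ≤ F.depth i + 1 := fun i =>
    anc_succ_le (F.val_avoidsUpTo (i + 1)) (Nat.lt_succ_self i)
  rw [Finset.prod_congr rfl fun i _ => halfGeometric_real_step (hle i), Finset.prod_mul_distrib,
    Finset.prod_pow_eq_pow_sum]
  -- The summands are the descents of `F.val`, whose final depth is `0`.
  have h1 : ∑ i ∈ Finset.range F.size, (F.depth i + 1 - F.depth (i + 1)) = F.size := by
    have := sum_descent (F.val_avoidsUpTo F.size)
    have h0 : anc F.val 0 F.size = 0 := F.depth_size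
    rwa [h0, add_zero] at this
  -- The shift is harmless because the depth vanishes at both ends; the factors then count the
  -- vertices that are not roots.
  have h2 : ∏ i ∈ Finset.range F.size, (if F.depth (i + 1) = 0 then (1 : ℝ) else 1 / 2) =
      ∏ i ∈ Finset.range F.size, (if F.depth i = 0 then (1 : ℝ) else 1 / 2) := by
    have e1 := Finset.prod_range_succ
      (fun i => if F.depth i = 0 then (1 : ℝ) else 1 / 2) F.size
    have e2 := Finset.prod_range_succ'
      (fun i => if F.depth i = 0 then (1 : ℝ) else 1 / 2) F.size
    have h0 : F.depth 0 = 0 := anc_self _ _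
    rw [e1] at e2
    simpa [F.depth_size, h0] using e2.symm
  have h3 : ∏ i ∈ Finset.range F.size, (if F.depth i = 0 then (1 : ℝ) else 1 / 2) =
      (1 / 2) ^ (F.size - F.numTrees) := by
    rw [Finset.prod_ite, Finset.prod_const_one, one_mul, Finset.prod_const]
    congr 1
    have := Finset.card_filter_add_card_filter_not (s := Finset.range F.size)
      (fun i => F.depth i = 0)
    have hr : (Finset.range F.size).filter (fun i => F.depth i = 0) =
        (Finset.range F.size).filter fun i => F.IsRoot i :=
      Finset.filter_congr fun i hi => F.depth_eq_zero_iff (Finset.mem_range.1 hi)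
    rw [hr, F.card_isRoot, Finset.card_range] at this
    omega
  rw [h1, h2, h3, ← pow_add, one_div_pow]
  have := F.numTrees_le_size
  congr 2
  omega

namespace RedTree

/-! ### Red trees and their descents -/

variable {k : ℕ}

/-- The values of the permutation of a red tree (`0` beyond its size). -/
def val (T : RedTree k) (i : ℕ) : ℕ := if h : i < k then (T.perm ⟨i, h⟩).val else 0

theorem val_coe (T : RedTree k) (i : Fin k) : T.val i = (T.perm i).val := by simp [val]

theorem val_mk (T : RedTree k) {i : ℕ} (h : i < k) : T.val i = (T.perm ⟨i, h⟩).val := by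
  simp [val, h]

theorem val_lt_val_iff (T : RedTree k) (i j : Fin k) : T.val i < T.val j ↔ T.perm i < T.perm j := by
  rw [val_coe, val_coe, Fin.lt_def]

/-- A `213` among the later points would form a `1324` with the root. -/
theorem val_avoidsUpTo (T : RedTree k) {n : ℕ} (hn : n < k) : AvoidsUpTo T.val n := by
  intro a b c hab hbc hcn h
  by_contra hlt
  have hk : 0 < k := by omega
  have hne : T.val b ≠ T.val a := by
    rw [T.val_mk (show b < k by omega), T.val_mk (show a < k by omega)]
    intro he
    have := T.perm.injective (Fin.ext he)
    simp only [Fin.mk.injEq] at this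
    omega
  have h0 := T.root_min ⟨0, hk⟩ ⟨b, by omega⟩ rfl
  rw [Fin.le_def, ← T.val_mk hk, ← T.val_mk (show b < k by omega)] at h0
  have hne0 : T.val 0 ≠ T.val b := by
    rw [T.val_mk (show b < k by omega), T.val_mk hk]
    intro he
    have := T.perm.injective (Fin.ext he)
    simp only [Fin.mk.injEq] at this
    omega
  have ha : a ≠ 0 := by rintro rfl; omega
  refine T.avoids ⟨⟨0, hk⟩, ⟨a, by omega⟩, ⟨b, by omega⟩, ⟨c, by omega⟩, ?_, hab, hbc, ?_, ?_, ?_⟩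
  · exact Nat.pos_of_ne_zero ha
  · rw [Fin.lt_def, ← T.val_mk hk, ← T.val_mk (show b < k by omega)]; omega
  · rw [Fin.lt_def, ← T.val_mk (show a < k by omega), ← T.val_mk (show b < k by omega)]; omega
  · rw [Fin.lt_def, ← T.val_mk (show a < k by omega), ← T.val_mk (show c < k by omega)]; omega

theorem eq_of_descent_eq {n : ℕ} {T T' : RedTree (n + 1)}
    (h : ∀ i < n, descent T.val i = descent T'.val i) : T = T' := by
  have hlt : ∀ a b : Fin (n + 1), a < b → (T.perm a < T.perm b ↔ T'.perm a < T'.perm b) := by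
    intro a b hab
    rw [← val_lt_val_iff, ← val_lt_val_iff]
    exact lt_iff_of_descent (T.val_avoidsUpTo (Nat.lt_succ_self n))
      (T'.val_avoidsUpTo (Nat.lt_succ_self n)) h a b hab (by omega)
  have hlt' : ∀ a b : Fin (n + 1), T.perm a < T.perm b → T'.perm a < T'.perm b := by
    intro a b hab
    rcases lt_trichotomy a b with h1 | rfl | h1
    · exact (hlt a b h1).1 hab
    · exact absurd hab (lt_irrefl _)
    · refine lt_of_le_of_ne (not_lt.1 fun hc => ?_) fun he => ?_
      · exact absurd ((hlt b a h1).2 hc) (not_lt.2 hab.le)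
      · exact h1.ne' (T'.perm.injective he)
  -- Both permutations order the points alike, so this is an increasing bijection of a finite chain,
  -- hence the identity.
  have hmono : StrictMono fun x => T'.perm (T.perm.symm x) := by
    intro x y hxy
    exact hlt' _ _ (by simpa using hxy)
  have hid : (fun x => T'.perm (T.perm.symm x)) = id := by
    refine (hmono.range_inj strictMono_id).1 ?_
    rw [Set.range_id]
    exact (T'.perm.surjective.comp T.perm.symm.surjective).range_eq
  ext1
  ext1 i
  have := congrFun hid (T.perm i)
  simpa using this.symm

theorem hasseCover_iff_covers (T : RedTree k) (i j : Fin k) :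
    HasseCover T.perm i j ↔ Covers T.val i j := by
  unfold HasseCover Covers
  rw [val_lt_val_iff, Fin.lt_def]
  refine and_congr_right fun _ => and_congr_right fun _ => not_congr ⟨?_, ?_⟩
  · rintro ⟨l, h1, h2, h3, h4⟩
    exact ⟨l, h1, h2, (T.val_lt_val_iff _ _).2 h3, (T.val_lt_val_iff _ _).2 h4⟩
  · rintro ⟨l, h1, h2, h3, h4⟩
    exact ⟨⟨l, by omega⟩, h1, h2, (T.val_lt_val_iff _ ⟨l, by omega⟩).1 h3,
      (T.val_lt_val_iff ⟨l, by omega⟩ _).1 h4⟩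

theorem graph_adj_iff (T : RedTree k) {i j : Fin k} (h : i < j) :
    T.graph.Adj i j ↔ Covers T.val i j := by
  rw [graph, hasseGraph, SimpleGraph.fromRel_adj, hasseCover_iff_covers, hasseCover_iff_covers]
  constructor
  · rintro ⟨_, h' | h'⟩
    · exact h'
    · exact absurd h'.1 (not_lt.2 h.le)
  · exact fun h' => ⟨h.ne, Or.inl h'⟩

theorem _root_.PlaneForest.graph_adj_iff (F : PlaneForest) {i j : Fin F.size} (h : i < j) :
    F.graph.Adj i j ↔ Covers F.val i j := by
  rw [PlaneForest.graph, SimpleGraph.fromRel_adj, F.isChild_iff_covers _ _ j.2,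
    F.isChild_iff_covers _ _ i.2]
  constructor
  · rintro ⟨_, h' | h'⟩
    · exact h'
    · exact absurd h'.1 (not_lt.2 h.le)
  · exact fun h' => ⟨h.ne, Or.inl h'⟩

theorem mem_redForest_iff (T : RedTree k) {p : Fin k} (hp : p.val + 1 < k) (w : Fin k) :
    w ∈ T.redForest p ↔ w ≤ p ∧ w.val ≠ 0 ∧
      ∀ a : Fin k, w ≤ a → a ≤ p → ¬ T.val a < T.val (p.val + 1) := by
  classical
  simp only [redForest, Set.mem_ofPred_eq]
  refine and_congr_right fun _ => and_congr_right fun _ => ⟨?_, ?_⟩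
  · intro h a hwa hap hlt
    -- The rightmost vertex below `p + 1` is a parent of it, so it would have to lie to the left of
    -- `w`.
    obtain ⟨b, hb, hmax⟩ := Finset.exists_max_image
      (Finset.univ.filter fun a : Fin k => w ≤ a ∧ a ≤ p ∧ T.val a < T.val (p.val + 1)) id
      ⟨a, by simp [hwa, hap, hlt]⟩
    simp only [Finset.mem_filter, Finset.mem_univ, true_and, id] at hb hmax
    refine absurd (h ⟨p.val + 1, hp⟩ b rfl ?_) (not_lt.2 hb.1)
    rw [IsParent, hasseCover_iff_covers]
    refine ⟨Nat.lt_succ_of_le hb.2.1, hb.2.2, ?_⟩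
    rintro ⟨l, h1, h2, h3, h4⟩
    have hl : l ≤ p.val := Nat.le_of_lt_succ h2
    have h5 := hmax ⟨l, by omega⟩ ⟨hb.1.trans (le_of_lt h1), hl, h4⟩
    exact absurd h1 (not_lt.2 h5)
  · intro h v x hv hx
    rw [IsParent, hasseCover_iff_covers] at hx
    by_contra hlt
    refine h x (not_lt.1 hlt) (Fin.le_def.2 ?_) ?_
    · have := hx.1; omega
    · rw [← hv]; exact hx.2.1

/-- The vertices of the window of length `m` at `s`. -/
def windowVertex {s m : ℕ} (h : s + m < k) (a : Fin m) : Fin k := ⟨s + a, by omega⟩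

/-- The fringe of a position, in terms of the order of the values. -/
theorem hasFringe_iff_lt (T : RedTree k) (F : PlaneForest) {s : ℕ} (hs : s ≠ 0) {p : Fin k}
    (hp : s + F.size = p.val + 1) (hpk : p.val + 1 < k) :
    T.HasFringe F p ↔ (∀ a < F.size, ¬ T.val (s + a) < T.val (s + F.size)) ∧
      ∀ a b, a < b → b < F.size → (Covers T.val (s + a) (s + b) ↔ Covers F.val a b) := by
  have hk : s + F.size < k := by omega
  set φ : Fin F.size → Fin k := windowVertex hk with hφ
  have hφv : ∀ a, (φ a).val = s + a := fun _ => rfl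
  have hφm : ∀ a b, φ a < φ b ↔ a < b := by
    intro a b
    rw [Fin.lt_def, hφv, hφv, Fin.lt_def]
    omega
  have hφi : Function.Injective φ := by
    intro a b h
    have := congrArg Fin.val h
    rw [hφv, hφv] at this
    exact Fin.ext (by omega)
  have hrange : Set.range φ = {w : Fin k | s ≤ w.val ∧ w ≤ p} := by
    ext w
    simp only [Set.mem_range, Set.mem_ofPred_eq]
    constructor
    · rintro ⟨a, rfl⟩
      rw [Fin.le_def, hφv]
      omega
    · rintro ⟨h1, h2⟩
      rw [Fin.le_def] at h2
      exact ⟨⟨w.val - s, by omega⟩, Fin.ext (by rw [hφv]; simp only; omega)⟩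
  constructor
  · rintro ⟨S, hSR, hcard, hup, e, he⟩
    -- `S` is closed to the right up to `p`, so its cardinality forces it to be the interval from
    -- `s` to `p`.
    have hup' : ∀ s ∈ S, ∀ w, s ≤ w → w ≤ p → w ∈ S := by
      intro s hs w hsw hwp
      by_contra hw
      have h1 := (T.mem_redForest_iff hpk s).1 (hSR hs)
      refine absurd (hup w ⟨(T.mem_redForest_iff hpk w).2 ⟨hwp, ?_, ?_⟩, hw⟩ s hs) (not_lt.2 hsw)
      · have := h1.2.1
        rw [Fin.le_def] at hsw
        omega
      · intro a hwa hap
        exact h1.2.2 a (hsw.trans hwa) hap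
    have hS : S = Set.range φ := by
      rw [hrange]
      rcases S.eq_empty_or_nonempty with rfl | hne
      · ext w
        rw [Set.ncard_empty] at hcard
        simp only [Set.mem_empty_iff_false, Set.mem_ofPred_eq, Fin.le_def, false_iff]
        omega
      · obtain ⟨x, hx, hmin⟩ := Set.exists_min_image S id S.toFinite hne
        simp only [id] at hmin
        have hIcc : S = ↑(Finset.Icc x p) := by
          ext w
          simp only [Finset.coe_Icc, Set.mem_Icc]
          exact ⟨fun hw => ⟨hmin w hw, (hSR hw).1⟩, fun hw => hup' x hx w hw.1 hw.2⟩
        have hxp : x.val ≤ p.val := (hSR hx).1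
        rw [hIcc, Set.ncard_coe_finset, Fin.card_Icc] at hcard
        rw [hIcc]
        ext w
        simp only [Finset.coe_Icc, Set.mem_Icc, Set.mem_ofPred_eq, Fin.le_def]
        omega
    subst hS
    -- An increasing bijection of `Fin F.size` is the identity, so `e` can only be the translation
    -- by `s`.
    have hid : (fun a => e ⟨φ a, a, rfl⟩) = id := by
      have hmono : StrictMono fun a => e ⟨φ a, a, rfl⟩ := fun a b hab =>
        (he _ _).1 (Subtype.mk_lt_mk.2 ((hφm a b).2 hab))
      refine (hmono.range_inj strictMono_id).1 ?_
      rw [Set.range_id]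
      refine Function.Surjective.range_eq fun y => ?_
      obtain ⟨⟨w, a, rfl⟩, rfl⟩ := e.surjective y
      exact ⟨a, rfl⟩
    refine ⟨fun a ha => ?_, fun a b hab hb => ?_⟩
    · have h1 := (T.mem_redForest_iff hpk (φ ⟨a, ha⟩)).1 (hSR ⟨_, rfl⟩)
      have := h1.2.2 (φ ⟨a, ha⟩) le_rfl h1.1
      rw [hp]
      exact this
    · have h1 := e.map_rel_iff (a := ⟨φ ⟨a, by omega⟩, _, rfl⟩) (b := ⟨φ ⟨b, hb⟩, _, rfl⟩)
      have ha' := congrFun hid ⟨a, by omega⟩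
      have hb' := congrFun hid ⟨b, hb⟩
      simp only [id] at ha' hb'
      rw [ha', hb', F.graph_adj_iff (Fin.mk_lt_mk.2 hab)] at h1
      rw [h1, SimpleGraph.comap_adj]
      exact (T.graph_adj_iff (i := φ ⟨a, by omega⟩) (j := φ ⟨b, hb⟩)
        ((hφm _ _).2 (Fin.mk_lt_mk.2 hab))).symm
  · rintro ⟨h0, hcov⟩
    refine ⟨Set.range φ, ?_, ?_, ?_, ?_⟩
    · rintro w ⟨a, rfl⟩
      refine (T.mem_redForest_iff hpk _).2 ⟨?_, ?_, fun b hb hbp => ?_⟩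
      · rw [Fin.le_def, hφv]; omega
      · rw [hφv]; omega
      · rw [Fin.le_def, hφv] at hb
        rw [Fin.le_def] at hbp
        have := h0 (b.val - s) (by omega)
        rwa [hp, show s + (b.val - s) = b.val by omega] at this
    · rw [← Set.image_univ, Set.ncard_image_of_injective _ hφi, Set.ncard_univ, Nat.card_fin]
    · rintro w ⟨hw, hw'⟩ x ⟨a, rfl⟩
      rw [hrange] at hw'
      have := hw.1
      simp only [Set.mem_ofPred_eq, Fin.le_def, not_and] at hw' this
      rw [Fin.lt_def, hφv]
      omega
    · set E : Fin F.size ≃ Set.range φ := Equiv.ofInjective φ hφi with hE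
      have hadj : ∀ a b : Fin F.size, F.graph.Adj a b ↔ T.graph.Adj (φ a) (φ b) := by
        have key : ∀ a b : Fin F.size, a < b → (F.graph.Adj a b ↔ T.graph.Adj (φ a) (φ b)) := by
          intro a b hab
          rw [F.graph_adj_iff hab, T.graph_adj_iff ((hφm a b).2 hab), hφv, hφv]
          exact (hcov a b hab b.2).symm
        intro a b
        rcases lt_trichotomy a b with h | rfl | h
        · exact key a b h
        · simp
        · rw [SimpleGraph.adj_comm, key b a h, SimpleGraph.adj_comm]
      refine ⟨⟨E.symm, ?_⟩, ?_⟩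
      · intro x y
        obtain ⟨a, rfl⟩ := E.surjective x
        obtain ⟨b, rfl⟩ := E.surjective y
        rw [Equiv.symm_apply_apply, Equiv.symm_apply_apply, hadj]
        rfl
      · intro x y
        obtain ⟨a, rfl⟩ := E.surjective x
        obtain ⟨b, rfl⟩ := E.surjective y
        change E a < E b ↔ E.symm (E a) < E.symm (E b)
        rw [Equiv.symm_apply_apply, Equiv.symm_apply_apply]
        exact hφm a b

/-- The sets of descents that realise a plane forest. -/
def _root_.PlaneForest.descentSet (F : PlaneForest) (i : ℕ) : Set ℕ :=
  {d | F.depth i + 1 - d = F.depth (i + 1)}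

/-- The fringe of a position is a window pattern of the descents. -/
theorem hasFringe_iff_mem_windowEvent (T : RedTree k) (F : PlaneForest) {s : ℕ} (hs : s ≠ 0)
    {p : Fin k} (hp : s + F.size = p.val + 1) (hpk : p.val + 1 < k) :
    T.HasFringe F p ↔ descent T.val ∈ windowEvent F.descentSet F.size s := by
  have hav : AvoidsUpTo T.val (s + F.size) := T.val_avoidsUpTo (by omega)
  have hav' : AvoidsUpTo (fun j => T.val (s + j)) F.size := fun a b c h1 h2 h3 h =>
    hav _ _ _ (by omega) (by omega) (by omega) h
  rw [hasFringe_iff_lt T F hs hp hpk]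
  have hcov : ∀ a b, Covers T.val (s + a) (s + b) ↔ Covers (fun j => T.val (s + j)) a b := by
    intro a b
    unfold Covers
    refine and_congr (by omega) (and_congr_right fun _ => not_congr ⟨?_, ?_⟩)
    · rintro ⟨l, h1, h2, h3⟩
      refine ⟨l - s, by omega, by omega, ?_⟩
      simpa only [show s + (l - s) = l by omega] using h3
    · rintro ⟨l, h1, h2, h3⟩
      exact ⟨s + l, by omega, by omega, h3⟩
  simp only [hcov, covers_iff_iff_lt_iff]
  have hstep : descent T.val ∈ windowEvent F.descentSet F.size s ↔
      ∀ i ≤ F.size, anc (fun j => T.val (s + j)) 0 i = anc F.val 0 i := by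
    simp only [anc_shift]
    constructor
    · intro h i hi
      induction i with
      | zero => simp
      | succ i ih =>
        rw [← add_assoc, anc_succ hav (by omega) (by omega), ih (by omega)]
        exact h i (by omega)
    · intro h i hi
      have := anc_succ hav (show s + i < s + F.size by omega) (by omega : s ≤ s + i)
      rw [add_assoc, h (i + 1) (by omega), h i (by omega)] at this
      exact this.symm
  rw [hstep, anc_eq_iff_lt_iff hav' (F.val_avoidsUpTo _)]
  -- Comparisons with the phantom vertex at `F.size` always fail, so the case `b = F.size` says
  -- exactly that the window contains no vertex below `p + 1`.
  have hm0 : F.val F.size = 0 := F.val_of_size_le _ le_rfl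
  constructor
  · rintro ⟨h0, h⟩ a b hab hb
    rcases hb.lt_or_eq with hb | rfl
    · exact h a b hab hb
    · rw [hm0]
      exact ⟨fun h' => absurd h' (h0 a hab), fun h' => by omega⟩
  · intro h
    refine ⟨fun a ha h' => ?_, fun a b hab hb => h a b hab hb.le⟩
    have := (h a F.size ha le_rfl).1 h'
    omega

open Classical in
theorem abs_ncard_hasFringe_sub_le (F : PlaneForest) {m : ℕ} (hm : F.size = m) (N : ℕ)
    (T : RedTree (N + m + 1)) :
    |({p | T.HasFringe F p}.ncard : ℝ) - ∑ s ∈ Finset.range N,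
      (windowEvent F.descentSet m (s + 1)).indicator 1 (descent T.val)| ≤ m + 1 := by
  set W := (Finset.range N).filter fun s => descent T.val ∈ windowEvent F.descentSet m (s + 1)
    with hW
  have hsum : ∑ s ∈ Finset.range N,
      (windowEvent F.descentSet m (s + 1)).indicator 1 (descent T.val) = (W.card : ℝ) := by
    rw [hW, Finset.card_filter]
    push_cast
    exact Finset.sum_congr rfl fun s _ => by simp [Set.indicator_apply]
  set Q := (Finset.range (N + m + 1)).filter fun p =>
    ∃ h : p < N + m + 1, T.HasFringe F ⟨p, h⟩ with hQ
  have hQcard : {p | T.HasFringe F p}.ncard = Q.card := by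
    rw [← Set.ncard_coe_finset, ← Set.ncard_image_of_injective _ Fin.val_injective]
    congr 1
    ext p
    simp only [Set.mem_image, Set.mem_ofPred_eq, hQ, Finset.coe_filter, Finset.mem_range]
    constructor
    · rintro ⟨p, hp, rfl⟩
      exact ⟨p.2, p.2, hp⟩
    · rintro ⟨h, h', hp⟩
      exact ⟨⟨p, h⟩, hp, rfl⟩
  have hkey : ∀ s < N, (s ∈ W ↔ s + m ∈ Q) := by
    intro s hs
    simp only [hW, hQ, Finset.mem_filter, Finset.mem_range, hs, true_and]
    have hwin := T.hasFringe_iff_mem_windowEvent F (s := s + 1) (by omega)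
      (p := ⟨s + m, by omega⟩) (by simp only; omega) (by simp only; omega)
    rw [hm] at hwin
    rw [← hwin]
    exact ⟨fun h => ⟨by omega, by omega, h⟩, fun h => h.2.2⟩
  have hWN : ∀ s ∈ W, s < N := fun s hs => by
    rw [hW, Finset.mem_filter, Finset.mem_range] at hs
    exact hs.1
  have h1 : W.card ≤ Q.card := by
    refine Finset.card_le_card_of_injOn (fun s => s + m) (fun s hs => ?_) (fun a _ b _ h => ?_)
    · exact (hkey s (hWN s hs)).1 hs
    · simp only at h; omega
  have h2 : Q.card ≤ W.card + (m + 1) := by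
    -- The window starting at `s + 1`, which skips the root, ends at position `s + m`. This misses
    -- only the first `m` positions and the last one.
    have hsub : Q ⊆ W.image (fun s => s + m) ∪ (insert (N + m) (Finset.range m)) := by
      intro p hp
      have hp' := hp
      rw [hQ, Finset.mem_filter, Finset.mem_range] at hp'
      simp only [Finset.mem_union, Finset.mem_image, Finset.mem_insert, Finset.mem_range]
      by_cases h1 : p = N + m
      · exact Or.inr (Or.inl h1)
      by_cases h2 : p < m
      · exact Or.inr (Or.inr h2)
      · refine Or.inl ⟨p - m, (hkey (p - m) (by omega)).2 ?_, by omega⟩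
        rwa [show p - m + m = p by omega]
    calc Q.card ≤ _ := Finset.card_le_card hsub
      _ ≤ _ := Finset.card_union_le _ _
      _ ≤ W.card + (m + 1) := by
        refine add_le_add Finset.card_image_le ((Finset.card_insert_le _ _).trans ?_)
        rw [Finset.card_range]
  rw [hsum, hQcard, abs_le]
  have h1' : (W.card : ℝ) ≤ Q.card := by exact_mod_cast h1
  have h2' : (Q.card : ℝ) ≤ W.card + (m + 1) := by exact_mod_cast h2
  have : (0 : ℝ) ≤ m := by positivity
  constructor <;> linarith

/-! ### The number of red trees -/

/-- The red tree whose principal subtrees form a given plane forest. -/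
noncomputable def ofForest (F : PlaneForest) {n : ℕ} (h : F.size = n) : RedTree (n + 1) where
  perm := Equiv.ofBijective
    (fun i : Fin (n + 1) => (⟨(PlaneForest.cons F .nil).val i, by
      have := (PlaneForest.cons F .nil).val_lt i (by simp only [PlaneForest.size]; omega)
      simp only [PlaneForest.size] at this
      omega⟩ : Fin (n + 1)))
    (Finite.injective_iff_bijective.1 fun i j hij => Fin.ext
      ((PlaneForest.cons F .nil).val_injOn i (by simp only [PlaneForest.size]; omega) j
        (by simp only [PlaneForest.size]; omega) (congrArg Fin.val hij)))
  nonempty := Nat.succ_pos n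
  avoids := by
    rintro ⟨a, b, c, d, _, hbc, hcd, _, h2, h3⟩
    exact absurd ((PlaneForest.cons F .nil).val_avoids b c d hbc hcd h3) (not_lt.2 (le_of_lt h2))
  root_min := by
    intro i j hi
    rw [Fin.le_def]
    simp only [Equiv.ofBijective_apply, hi, PlaneForest.val_cons_zero, PlaneForest.size]
    omega

theorem ofForest_injective {F G : PlaneForest} {n : ℕ} (hF : F.size = n) (hG : G.size = n)
    (h : ofForest F hF = ofForest G hG) : F = G := by
  refine F.eq_of_val_eq G (hF.trans hG.symm) fun i hi => ?_
  have h1 := congrArg (fun T : RedTree (n + 1) => (T.perm ⟨1 + i, by omega⟩).val) h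
  simp only [ofForest, Equiv.ofBijective_apply] at h1
  rw [PlaneForest.val_cons_left _ _ hi, PlaneForest.val_cons_left _ _ (by omega)] at h1
  omega

/-- The plane forest of a binary tree. -/
def _root_.PlaneForest.ofBinaryTree : BinaryTree Unit → PlaneForest
  | .nil => .nil
  | .node _ l r => .cons (ofBinaryTree l) (ofBinaryTree r)

theorem _root_.PlaneForest.size_ofBinaryTree (t : BinaryTree Unit) :
    (PlaneForest.ofBinaryTree t).size = t.numNodes := by
  induction t with
  | nil => rfl
  | node _ l r ihl ihr =>
    simp only [PlaneForest.ofBinaryTree, PlaneForest.size, BinaryTree.numNodes, ihl, ihr]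
    omega

theorem _root_.PlaneForest.ofBinaryTree_injective :
    Function.Injective PlaneForest.ofBinaryTree := by
  intro t
  induction t with
  | nil => intro t' h; cases t' with
    | nil => rfl
    | node _ l r => simp [PlaneForest.ofBinaryTree] at h
  | node _ l r ihl ihr => intro t' h; cases t' with
    | nil => simp [PlaneForest.ofBinaryTree] at h
    | node _ l' r' =>
      simp only [PlaneForest.ofBinaryTree, PlaneForest.cons.injEq] at h
      rw [ihl h.1, ihr h.2]

/-- First-child/next-sibling encoding of binary trees by forests; the transfer to uniform trees
needs only this lower bound. -/
theorem catalan_le_card (n : ℕ) : catalan n ≤ Nat.card (RedTree (n + 1)) := by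
  rw [← BinaryTree.treesOfNumNodesEq_card_eq_catalan, ← Nat.card_eq_finsetCard]
  refine Nat.card_le_card_of_injective
    (fun t : BinaryTree.treesOfNumNodesEq n => ofForest (PlaneForest.ofBinaryTree t.1)
      ((PlaneForest.size_ofBinaryTree _).trans (BinaryTree.mem_treesOfNumNodesEq.1 t.2))) ?_
  intro t t' h
  exact Subtype.ext (PlaneForest.ofBinaryTree_injective (ofForest_injective _ _ h))

theorem four_pow_le_card (n : ℕ) :
    (4 : ℝ) ^ n ≤ 2 * (n + 1) ^ 2 * Nat.card (RedTree (n + 1)) := by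
  have h1 : 4 ^ n ≤ 2 * (n + 1) * n.centralBinom := by
    rcases Nat.eq_zero_or_pos n with rfl | hn
    · simp
    · refine (Nat.four_pow_le_two_mul_self_mul_centralBinom n hn).trans ?_
      exact Nat.mul_le_mul_right _ (by omega)
  have h2 : n.centralBinom = (n + 1) * catalan n := by
    rw [catalan_eq_centralBinom_div, Nat.mul_div_cancel' n.succ_dvd_centralBinom]
  have h3 : 4 ^ n ≤ 2 * (n + 1) ^ 2 * Nat.card (RedTree (n + 1)) := by
    calc 4 ^ n ≤ 2 * (n + 1) * n.centralBinom := h1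
      _ = 2 * (n + 1) ^ 2 * catalan n := by rw [h2]; ring
      _ ≤ _ := Nat.mul_le_mul_left _ (catalan_le_card n)
  exact_mod_cast h3

theorem card_pos (n : ℕ) : 0 < Nat.card (RedTree (n + 1)) := by
  have h := four_pow_le_card n
  by_contra hc
  have h0 : Nat.card (RedTree (n + 1)) = 0 := by omega
  rw [h0] at h
  have : (0 : ℝ) < 4 ^ n := by positivity
  simp only [Nat.cast_zero, mul_zero] at h
  linarith

/-! ### Random red trees -/

instance (n : ℕ) : IsProbabilityMeasure (redTreeLaw (n + 1)) := by
  have := (Nat.card_pos_iff.1 (card_pos n)).1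
  exact isProbabilityMeasure_uniformOn' Set.finite_univ Set.univ_nonempty MeasurableSet.univ

theorem redTreeLaw_real (k : ℕ) (S : Set (RedTree k)) :
    (redTreeLaw k).real S = S.ncard / Nat.card (RedTree k) := by
  let _ := Fintype.ofFinite (RedTree k)
  rw [redTreeLaw, measureReal_def, uniformOn_univ, ENNReal.toReal_div,
    Measure.count_apply_finite _ S.toFinite, Nat.card_eq_fintype_card,
    Set.ncard_eq_toFinset_card S S.toFinite]
  simp

/-- An event for the descents of a random red tree is at most polynomially more likely than for
independent geometric variables. -/
theorem redTreeLaw_real_le (n : ℕ) (S : Set (RedTree (n + 1))) (B : Set (ℕ → ℕ))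
    (h : ∀ T ∈ S, prefixEvent n (descent T.val) ⊆ B) :
    (redTreeLaw (n + 1)).real S ≤ 2 * (n + 1) ^ 2 * geometricSequence.real B := by
  classical
  have hc : (0 : ℝ) < Nat.card (RedTree (n + 1)) := by exact_mod_cast card_pos n
  set Sf := S.toFinite.toFinset with hSf
  -- Distinct trees have disjoint prefix events, each of weight at least `4⁻ⁿ` and contained in `B`.
  have h1 : (Sf.card : ℝ) * (1 / 4) ^ n ≤ geometricSequence.real B := by
    calc (Sf.card : ℝ) * (1 / 4) ^ n = ∑ _T ∈ Sf, (1 / 4 : ℝ) ^ n := by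
          rw [Finset.sum_const, nsmul_eq_mul]
      _ ≤ ∑ T ∈ Sf, geometricSequence.real (prefixEvent n (descent T.val)) := by
          refine Finset.sum_le_sum fun T _ => le_measure_prefixEvent ?_
          have := sum_descent (T.val_avoidsUpTo (Nat.lt_succ_self n))
          omega
      _ = geometricSequence.real (⋃ T ∈ Sf, prefixEvent n (descent T.val)) := by
          rw [measureReal_biUnion_finset]
          · intro T _ T' _ hne
            refine Set.disjoint_left.2 fun x hx hx' => hne (eq_of_descent_eq fun i hi => ?_)
            rw [← hx i hi, ← hx' i hi]
          · intro T _
            rw [prefixEvent_eq]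
            exact measurableSet_windowEvent _ _ _
      _ ≤ geometricSequence.real B := by
          refine measureReal_mono (Set.iUnion₂_subset fun T hT => h T ?_) (measure_ne_top _ _)
          simpa [hSf] using hT
  rw [redTreeLaw_real, Set.ncard_eq_toFinset_card S S.toFinite, div_le_iff₀ hc]
  have h4 : (1 / 4 : ℝ) ^ n * 4 ^ n = 1 := by rw [← mul_pow]; norm_num
  calc (Sf.card : ℝ) = Sf.card * (1 / 4) ^ n * 4 ^ n := by rw [mul_assoc, h4, mul_one]
    _ ≤ geometricSequence.real B * (2 * (n + 1) ^ 2 * Nat.card (RedTree (n + 1))) :=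
      mul_le_mul h1 (four_pow_le_card n) (by positivity) measureReal_nonneg
    _ = _ := by ring

end RedTree

/-! ### Concentration and limiting mean of the proportion. -/

namespace RedTree

theorem windowDeviation_congr {A : ℕ → Set ℕ} {m p : ℕ} {x y : ℕ → ℕ}
    (h : ∀ i < m, x (p + i) = y (p + i)) : windowDeviation A m p x = windowDeviation A m p y := by
  have : x ∈ windowEvent A m p ↔ y ∈ windowEvent A m p :=
    forall₂_congr fun i hi => by rw [h i hi]
  classical
  simp only [windowDeviation, Set.indicator_apply, this, Pi.one_apply]

/-- The limiting proportion of positions with a given fringe. -/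
noncomputable def _root_.PlaneForest.limitProportion (F : PlaneForest) : ℝ :=
  1 / 2 ^ (2 * F.size - F.numTrees)

theorem _root_.PlaneForest.limitProportion_mem_Icc (F : PlaneForest) :
    F.limitProportion ∈ Set.Icc (0 : ℝ) 1 := by
  unfold PlaneForest.limitProportion
  refine ⟨by positivity, ?_⟩
  rw [div_le_one (by positivity)]
  exact one_le_pow₀ (by norm_num)

/-- The `m + 1` positions without a window shift the count and its target by at most `m + 1` each.
The condition `hNε` lets half of `ε` pay for both shifts. -/
theorem redTreeLaw_real_deviation_le (F : PlaneForest) {ε : ℝ} (hε : 0 < ε) {m : ℕ}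
    (hm : F.size = m) {N : ℕ} (hN : 0 < N) (hNε : 2 * ((m : ℝ) + 1) ≤ ε / 2 * (N + m + 1)) :
    (redTreeLaw (N + m + 1)).real {T | ε < |T.rhoPlus F - F.limitProportion|} ≤
      2 * ((N + m : ℕ) + 1) ^ 2 *
        (2 * (m + 1) * Real.exp (-(2 * (ε / 2 / (m + 1)) ^ 2 * N))) := by
  refine (redTreeLaw_real_le (N + m) _
    {x | ε / 2 * N ≤ |∑ s ∈ Finset.range N, windowDeviation F.descentSet m (s + 1) x|} ?_).trans
    (mul_le_mul_of_nonneg_left (measure_abs_sum_window_ge_le F.descentSet m N (half_pos hε) hN)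
      (by positivity))
  intro T hT x hx
  have hcongr : ∑ s ∈ Finset.range N, windowDeviation F.descentSet m (s + 1) x =
      ∑ s ∈ Finset.range N, windowDeviation F.descentSet m (s + 1) (descent T.val) := by
    refine Finset.sum_congr rfl fun s hs => windowDeviation_congr fun i hi => hx _ ?_
    have := Finset.mem_range.1 hs
    omega
  have hq : ∏ i ∈ Finset.range m, halfGeometric.real (F.descentSet i) = F.limitProportion := by
    rw [← hm]; exact prod_halfGeometric_depth F
  have hsum : ∑ s ∈ Finset.range N, windowDeviation F.descentSet m (s + 1) (descent T.val) =
      ∑ s ∈ Finset.range N, (windowEvent F.descentSet m (s + 1)).indicator 1 (descent T.val) -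
        N * F.limitProportion := by
    simp only [windowDeviation, hq, Finset.sum_sub_distrib, Finset.sum_const, Finset.card_range,
      nsmul_eq_mul]
  rw [Set.mem_ofPred_eq, hcongr, hsum]
  have habs := abs_le.1 (abs_ncard_hasFringe_sub_le F hm N T)
  set C : ℝ := ({p | T.HasFringe F p}.ncard : ℝ) with hC
  set W : ℝ := ∑ s ∈ Finset.range N,
    (windowEvent F.descentSet m (s + 1)).indicator 1 (descent T.val)
  have hk : (0 : ℝ) < N + m + 1 := by positivity
  have hrho : T.rhoPlus F - F.limitProportion =
      (C - F.limitProportion * (N + m + 1)) / (N + m + 1) := by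
    rw [rhoPlus, ← hC, sub_div, mul_div_cancel_right₀ _ hk.ne']
    push_cast
    rfl
  rw [Set.mem_ofPred_eq, hrho, abs_div, abs_of_pos hk, lt_div_iff₀ hk] at hT
  have hqm := F.limitProportion_mem_Icc
  have hm0 : (0 : ℝ) ≤ (m : ℝ) + 1 := by positivity
  have hqm1 : F.limitProportion * (m + 1) ≤ m + 1 := mul_le_of_le_one_left hm0 hqm.2
  have hqm0 : 0 ≤ F.limitProportion * (m + 1) := mul_nonneg hqm.1 hm0
  have hεm : 0 ≤ ε / 2 * (m + 1) := by positivity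
  rcases lt_abs.1 hT with h | h
  · refine le_trans ?_ (le_abs_self _)
    linarith [habs.2]
  · refine le_trans ?_ (neg_le_abs _)
    linarith [habs.1]

theorem tendsto_polynomial_mul_exp {c : ℝ} (hc : 0 < c) (D : ℝ) (m : ℕ) :
    Tendsto (fun N : ℕ => 2 * (((N + m : ℕ) : ℝ) + 1) ^ 2 * (D * Real.exp (-(c * N)))) atTop
      (𝓝 0) := by
  have h1 : Tendsto (fun N : ℕ => c * (((N + m : ℕ) : ℝ) + 1)) atTop atTop := by
    refine Tendsto.const_mul_atTop hc (tendsto_atTop_add_const_right _ _ ?_)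
    exact tendsto_natCast_atTop_atTop.comp (tendsto_add_atTop_nat m)
  have h2 := ((Real.tendsto_pow_mul_exp_neg_atTop_nhds_zero 2).comp h1).const_mul
    (2 * D / c ^ 2 * Real.exp (c * (m + 1)))
  rw [mul_zero] at h2
  refine h2.congr fun N => ?_
  -- With `x = c * (N + m + 1)` the expression is a constant times `x ^ 2 * exp (-x)`.
  have : Real.exp (-(c * N)) =
      Real.exp (c * (m + 1)) * Real.exp (-(c * (((N + m : ℕ) : ℝ) + 1))) := by
    rw [← Real.exp_add]
    congr 1
    push_cast
    ring
  rw [this, Function.comp_apply]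
  field_simp

theorem tendsto_redTreeLaw_real_deviation (F : PlaneForest) {ε : ℝ} (hε : 0 < ε) :
    Tendsto (fun k => (redTreeLaw k).real {T | ε < |T.rhoPlus F - F.limitProportion|}) atTop
      (𝓝 0) := by
  obtain ⟨m, hm⟩ : ∃ m, F.size = m := ⟨_, rfl⟩
  rw [← tendsto_add_atTop_iff_nat (m + 1)]
  refine squeeze_zero' (Eventually.of_forall fun _ => measureReal_nonneg) ?_
    (tendsto_polynomial_mul_exp (c := 2 * (ε / 2 / (m + 1)) ^ 2) (by positivity) (2 * (m + 1)) m)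
  have h1 : Tendsto (fun N : ℕ => ε / 2 * ((N : ℝ) + m + 1)) atTop atTop :=
    Tendsto.const_mul_atTop (half_pos hε) (tendsto_atTop_add_const_right _ _
      (tendsto_atTop_add_const_right _ _ tendsto_natCast_atTop_atTop))
  filter_upwards [h1.eventually_ge_atTop (2 * ((m : ℝ) + 1)), eventually_gt_atTop 0] with N h2 h3
  exact redTreeLaw_real_deviation_le F hε hm h3 h2

theorem rhoPlus_mem_Icc {k : ℕ} (T : RedTree k) (F : PlaneForest) :
    T.rhoPlus F ∈ Set.Icc (0 : ℝ) 1 := by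
  refine ⟨by unfold rhoPlus; positivity, div_le_one_of_le₀ ?_ (by positivity)⟩
  have := Set.ncard_le_ncard (Set.subset_univ {p | T.HasFringe F p}) Set.finite_univ
  rw [Set.ncard_univ, Nat.card_fin] at this
  exact_mod_cast this

/-- The deviation is at most `δ` off the exceptional event, and at most `1` on it since both
quantities lie in `[0, 1]`. -/
theorem abs_integral_rhoPlus_sub_le (F : PlaneForest) (n : ℕ) {δ : ℝ} (hδ : 0 ≤ δ) :
    |∫ T, T.rhoPlus F ∂(redTreeLaw (n + 1)) - F.limitProportion| ≤
      δ + (redTreeLaw (n + 1)).real {T | δ < |T.rhoPlus F - F.limitProportion|} := by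
  classical
  set S : Set (RedTree (n + 1)) := {T | δ < |T.rhoPlus F - F.limitProportion|} with hS
  have h1 : ∫ T, T.rhoPlus F ∂(redTreeLaw (n + 1)) - F.limitProportion =
      ∫ T, (T.rhoPlus F - F.limitProportion) ∂(redTreeLaw (n + 1)) := by
    rw [integral_sub Integrable.of_finite Integrable.of_finite]
    simp
  have h2 : δ + (redTreeLaw (n + 1)).real S =
      ∫ T, (δ + S.indicator 1 T) ∂(redTreeLaw (n + 1)) := by
    rw [integral_add Integrable.of_finite Integrable.of_finite,
      integral_indicator_one MeasurableSpace.measurableSet_top]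
    simp
  rw [h1, h2]
  refine abs_integral_le_integral_abs.trans
    (integral_mono Integrable.of_finite Integrable.of_finite fun T => ?_)
  have hr := T.rhoPlus_mem_Icc F
  have hq := F.limitProportion_mem_Icc
  by_cases hT : T ∈ S
  · simp only [Set.indicator_of_mem hT, Pi.one_apply]
    refine (abs_le.2 ⟨?_, ?_⟩ : _ ≤ (1 : ℝ)).trans (by linarith)
    · linarith [hr.1, hq.2]
    · linarith [hr.2, hq.1]
  · simp only [Set.indicator_of_notMem hT, add_zero]
    exact not_lt.1 hT

end RedTree

theorem mainTheorem7 (F : PlaneForest) :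
    ConcentratedAt redTreeLaw (fun _ T => T.rhoPlus F)
      (1 / 2 ^ (2 * F.size - F.numTrees)) ∧
    Tendsto (fun k => ∫ T, T.rhoPlus F ∂(redTreeLaw k)) atTop
      (𝓝 (1 / 2 ^ (2 * F.size - F.numTrees))) := by
  constructor
  · intro ε hε
    filter_upwards [(RedTree.tendsto_redTreeLaw_real_deviation F hε).eventually_lt_const hε,
      eventually_gt_atTop 0] with k hk hk0
    obtain ⟨n, rfl⟩ := Nat.exists_eq_succ_of_ne_zero hk0.ne'
    have hcompl := probReal_compl_eq_one_sub (μ := redTreeLaw (n + 1))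
      (s := {T | ε < |T.rhoPlus F - F.limitProportion|}) MeasurableSpace.measurableSet_top
    have hset : {T : RedTree (n + 1) | |T.rhoPlus F - 1 / 2 ^ (2 * F.size - F.numTrees)| ≤ ε} =
        {T | ε < |T.rhoPlus F - F.limitProportion|}ᶜ := by
      ext T
      exact (not_lt (a := ε) (b := |T.rhoPlus F - F.limitProportion|)).symm
    change _ < (redTreeLaw (n + 1)).real
      {T | |T.rhoPlus F - 1 / 2 ^ (2 * F.size - F.numTrees)| ≤ ε}
    rw [hset, hcompl]
    linarith
  · change Tendsto _ _ (𝓝 F.limitProportion)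
    rw [Metric.tendsto_nhds]
    intro ε hε
    filter_upwards [(RedTree.tendsto_redTreeLaw_real_deviation F
      (half_pos hε)).eventually_lt_const (half_pos hε), eventually_gt_atTop 0] with k hk hk0
    obtain ⟨n, rfl⟩ := Nat.exists_eq_succ_of_ne_zero hk0.ne'
    rw [Real.dist_eq]
    have := RedTree.abs_integral_rhoPlus_sub_le F n (half_pos hε).le
    simp only [Nat.succ_eq_add_one] at hk ⊢
    linarith
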